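/- A sequence of complex numbers $s=(s_i)_{i\in I}$ is indexed by an integer interval $I$, finite or infinite. For a positive integer $n$ and a coefficient tuple $\mathbf a^\star=(a_0,a_1,\ldots,a_{\lfloor n/2\rfloor})\in\mathbb C^{\lfloor n/2\rfloor+1}$, let $\mathfrak S^\star_n(\mathbf a^\star)$ be the class of all sequences $s$ such that $$a_0s_is_{i+n}+a_1s_{i+1}s_{i+n-1}+\cdots+a_{\lfloor n/2\rfloor}s_{i+\lfloor n/2\rfloor}s_{i+\lceil n/2\rceil}=0$$ for all $i$ with $[i;i+n]\subseteq I$. The sequence $s$ is a Somos sequence of order $n$ if $s\in\mathfrak S^\star_n(\mathbf a^\star)$ for some $\mathbf a^\star$ with $a_0\neq0$, and it is a Somos sequence of nonstrict order $n$ if $s\in\mathfrak S^\star_n(\mathbf a^\star)$ for some $\mathbf a^\star\neq(0,\ldots,0)$. For a positive integer $d$, the decimations of $s$ by a factor of $d$ are the sequences $k\mapsto s_{r+dk}$, indexed by $\{k\in\mathbb Z : r+dk\in I\}$, with $r\in\mathbb Z$. **Proposition.** Let $s$ be a Somos sequence of order $7$ with nonzero terms. Then every decimation of $s$ by an even factor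 is a Somos sequence of nonstrict orders both $8$ and $9$, while every decimation of $s$ by an odd factor is a Somos sequence of nonstrict orders both $9$ and $16$. Furthermore, for each positive integer $d$ and each nonstrict order $n$ thus associated with $d$ ($n\in\{8,9\}$ if $d$ is even, $n\in\{9,16\}$ if $d$ is odd), there exist coefficients $\mathbf a^\star\neq(0,\ldots,0)$ such that all decimations of $s$ by a factor of $d$ belong to the same class $\mathfrak S^\star_n(\mathbf a^\star)$. These nonstrict orders are best possible. Namely, let $u$ be the unit Somos sequence of order $7$, i.e. the sequence indexed by $\mathbb Z$ with $u_0=u_1=\cdots=u_6=1$ and $u_iu_{i+7}=u_{i+1}u_{i+6}+u_{i+2}u_{i+5}+u_{i+3}u_{i+4}$ for all $i\in\mathbb Z$; it exists and all of its terms are nonzero. Then for every $n<8$ some decimation of $u$ by a factor of $2$ is not a Somos sequence of nonstrict order $n$; and for every odd $n<9$ as well as every even $n<16$ some decimation of $u$ by a factor of $3$ is not a Somos sequence of nonstrict order $n$. -/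

import Mathlib

/-!
A sequence of complex numbers is indexed by an integer interval, finite or infinite. It is
represented by its indexing interval `I : Set ℤ` (with `I.OrdConnected`) and by a function
`s : ℤ → ℂ` of which only the values on `I` are ever used.
-/

/-- The sequence `s` indexed by `I` belongs to the class with coefficient tuple
`a = (a₀, …, a_{⌊n/2⌋})`: one has
`a₀ sᵢ sᵢ₊ₙ + a₁ sᵢ₊₁ sᵢ₊ₙ₋₁ + ⋯ + a_{⌊n/2⌋} s_{i+⌊n/2⌋} s_{i+⌈n/2⌉} = 0`
for all valid `i`, i.e. whenever `[i; i + n] ⊆ I`. -/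
def InSomosClass (n : ℕ) (a : Fin (n / 2 + 1) → ℂ) (I : Set ℤ) (s : ℤ → ℂ) : Prop :=
  ∀ i : ℤ, Set.Icc i (i + (n : ℤ)) ⊆ I →
    ∑ j : Fin (n / 2 + 1), a j * s (i + ((j : ℕ) : ℤ)) * s (i + (n : ℤ) - ((j : ℕ) : ℤ)) = 0

/-- Somos sequence of order `n`: the leading coefficient is nonzero. -/
def IsSomos (n : ℕ) (I : Set ℤ) (s : ℤ → ℂ) : Prop :=
  ∃ a : Fin (n / 2 + 1) → ℂ, a 0 ≠ 0 ∧ InSomosClass n a I s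

/-- Somos sequence of nonstrict order `n`: the coefficients are not all zero. -/
def IsNonstrictSomos (n : ℕ) (I : Set ℤ) (s : ℤ → ℂ) : Prop :=
  ∃ a : Fin (n / 2 + 1) → ℂ, a ≠ 0 ∧ InSomosClass n a I s

/-- All terms of the sequence `s` indexed by `I` are nonzero. -/
def NonzeroTerms (I : Set ℤ) (s : ℤ → ℂ) : Prop :=
  ∀ i ∈ I, s i ≠ 0

/-- The indexing interval of the decimation `k ↦ s (r + d k)` of a sequence indexed by `I`. -/
def decimationIndex (d : ℕ) (r : ℤ) (I : Set ℤ) : Set ℤ :=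
  {k : ℤ | r + (d : ℤ) * k ∈ I}

/-- The decimation of `s` by a factor of `d` with offset `r`. Every integer `r` is allowed;
offsets congruent modulo `d` give the same decimation up to a shift of the index. -/
def decimation (d : ℕ) (r : ℤ) (s : ℤ → ℂ) : ℤ → ℂ :=
  fun k => s (r + (d : ℤ) * k)

/-- The nonstrict orders associated with a decimation factor, for order-7 Somos sequences:
`8` and `9` for even factors, `9` and `16` for odd ones. -/
def associatedOrders (d : ℕ) : Set ℕ :=
  {n | (Even d ∧ (n = 8 ∨ n = 9)) ∨ (Odd d ∧ (n = 9 ∨ n = 16))}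

/-- `u`, indexed by all of `ℤ`, is the unit Somos sequence of order `n`: the seed
`u₀, …, uₙ₋₁` and the coefficients of
`uᵢ uᵢ₊ₙ = uᵢ₊₁ uᵢ₊ₙ₋₁ + ⋯ + u_{i+⌊n/2⌋} u_{i+⌈n/2⌉}` are all `1`. -/
def IsUnitSomos (n : ℕ) (u : ℤ → ℂ) : Prop :=
  (∀ i : ℤ, 0 ≤ i → i < (n : ℤ) → u i = 1) ∧
  ∀ i : ℤ, u i * u (i + (n : ℤ)) =
    ∑ j ∈ Finset.Icc 1 (n / 2), u (i + (j : ℤ)) * u (i + (n : ℤ) - (j : ℤ))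

/-! The heart is a rank bound, `det_somosSeven_eq_zero`: for fixed `m`, the products `s (P + c) * s
(P + m - c)`, with rows `P` and columns `c`, form a matrix of rank at most four, provided that `m`
is odd or that `m` and all the `c` are even. Any five columns then satisfy a linear relation valid
in every row. For a factor `d`, take `m = d * n` and `c = d * j` with `j ≤ 4` and `n` equal to 8 or
9; for odd `d` the order 8 violates the parity condition, and order 16 with only even `j` replaces
it. Rows of all residues modulo `d` are treated at once, so one coefficient tuple serves all
offsets.

For two-dimensional theta series the bound is the addition formula `exists_thetaSeq_mul_eq_sum`: a
product of two series regroups into four row-times-column products, one for each class of summation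
indices modulo two. Instead of uniformizing every Somos sequence, only those near one explicit
two-soliton sequence over `ℚ_[7]` are treated. There the first eleven terms of a theta sequence have
invertible Jacobian in its eleven parameters, so nearby Somos data share their first eleven terms
with a theta sequence, and the rank bound propagates the recurrence to all later terms
(`eventually_exists_eq_thetaSeq`). The five-by-five minors are rational functions of the ten data;
vanishing on a 7-adic open set, their numerators are the zero polynomial, so the minors vanish over
every field (`det_somosSeven_eq_zero_of_eventually`).

Sharpness is a finite check: for each excluded order, enough instances of the relation for the unit
sequence form a square integer matrix that is invertible modulo a small prime. -/

open Filter Topology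

/-! ### Ultrametric estimates for products. -/

/-- Two elements of size at most `C` that are close relative to `C`; this bookkeeping predicate is
multiplicative in `C`. -/
structure NearPair {K : Type*} [NormedField K] (r d C : ℝ) (f g : K) : Prop where
  left : ‖f‖ ≤ C
  right : ‖g‖ ≤ C
  sub : ‖f - g‖ * r ≤ C * d

section NearPair
variable {K : Type*} [NormedField K] {r d : ℝ}

theorem norm_sub_le_max_of_ultrametric [IsUltrametricDist K] (x y z : K) : ‖x - z‖ ≤ max ‖x - y‖ ‖y - z‖ := by
  simpa [dist_eq_norm] using IsUltrametricDist.dist_triangle_max x y z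

theorem NearPair.mul [IsUltrametricDist K] (hr : 0 ≤ r) {C C' : ℝ} {f g f' g' : K}
    (h : NearPair r d C f g) (h' : NearPair r d C' f' g') :
    NearPair r d (C * C') (f * f') (g * g') := by
  have hC : 0 ≤ C := (norm_nonneg _).trans h.left
  have hC' : 0 ≤ C' := (norm_nonneg _).trans h'.left
  refine ⟨?_, ?_, ?_⟩
  · rw [norm_mul]; exact mul_le_mul h.left h'.left (norm_nonneg _) hC
  · rw [norm_mul]; exact mul_le_mul h.right h'.right (norm_nonneg _) hC
  · have h1 := norm_sub_le_max_of_ultrametric (f * f') (g * f') (g * g')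
    rw [← sub_mul, ← mul_sub, norm_mul, norm_mul] at h1
    refine (mul_le_mul_of_nonneg_right h1 hr).trans ?_
    rw [max_mul_of_nonneg _ _ hr]
    refine max_le ?_ ?_
    · calc ‖f - g‖ * ‖f'‖ * r = (‖f - g‖ * r) * ‖f'‖ := by ring
        _ ≤ (C * d) * C' := mul_le_mul h.sub h'.left (norm_nonneg _)
            ((mul_nonneg (norm_nonneg _) hr).trans h.sub)
        _ = C * C' * d := by ring
    · calc ‖g‖ * ‖f' - g'‖ * r = ‖g‖ * (‖f' - g'‖ * r) := by ring
        _ ≤ C * (C' * d) := mul_le_mul h.right h'.sub (mul_nonneg (norm_nonneg _) hr) hC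
        _ = C * C' * d := by ring

theorem NearPair.one (hd : 0 ≤ d) : NearPair r d 1 (1 : K) 1 :=
  ⟨by simp, by simp, by simpa using hd⟩

theorem NearPair.pow [IsUltrametricDist K] (hr : 0 ≤ r) (hd : 0 ≤ d) {C : ℝ} {f g : K} (h : NearPair r d C f g) (n : ℕ) :
    NearPair r d (C ^ n) (f ^ n) (g ^ n) := by
  induction n with
  | zero => simpa using NearPair.one hd
  | succ n ih => simpa [pow_succ] using ih.mul hr h

theorem NearPair.of_norm_eq_one (hr1 : r ≤ 1) {f g : K} (hf : ‖f‖ = 1) (hg : ‖g‖ = 1)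
    (h : ‖f - g‖ ≤ d) : NearPair r d 1 f g := by
  refine ⟨hf.le, hg.le, ?_⟩
  nlinarith [norm_nonneg (f - g)]

theorem NearPair.of_norm_le (hr : 0 ≤ r) {f g : K} (hf : ‖f‖ ≤ r) (hg : ‖g‖ ≤ r)
    (h : ‖f - g‖ ≤ d) : NearPair r d r f g :=
  ⟨hf, hg, by rw [mul_comm]; gcongr⟩

theorem NearPair.zpow_of_norm_eq_one [IsUltrametricDist K] (hr : 0 ≤ r) (hr1 : r ≤ 1) {f g : K} (hf : ‖f‖ = 1)
    (hg : ‖g‖ = 1) (h : ‖f - g‖ ≤ d) (n : ℤ) : NearPair r d 1 (f ^ n) (g ^ n) := by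
  have hd : 0 ≤ d := (norm_nonneg _).trans h
  have hf0 : f ≠ 0 := by rintro rfl; simp at hf
  have hg0 : g ≠ 0 := by rintro rfl; simp at hg
  obtain ⟨m, rfl | rfl⟩ := n.eq_nat_or_neg
  · simpa using (NearPair.of_norm_eq_one hr1 hf hg h).pow hr hd m
  · have : NearPair r d 1 f⁻¹ g⁻¹ := by
      refine .of_norm_eq_one hr1 (by simp [hf]) (by simp [hg]) ?_
      rw [inv_sub_inv hf0 hg0, norm_div, norm_mul, hf, hg, norm_sub_rev]
      simpa using h
    simpa using this.pow hr hd m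

theorem NearPair.prod [IsUltrametricDist K] (hr : 0 ≤ r) (hd : 0 ≤ d) {ι : Type*} (s : Finset ι) {C : ι → ℝ}
    {f g : ι → K} (h : ∀ i ∈ s, NearPair r d (C i) (f i) (g i)) :
    NearPair r d (∏ i ∈ s, C i) (∏ i ∈ s, f i) (∏ i ∈ s, g i) := by
  classical
  induction s using Finset.induction_on with
  | empty => simpa using NearPair.one hd
  | insert a s ha ih =>
    rw [Finset.prod_insert ha, Finset.prod_insert ha, Finset.prod_insert ha]
    exact (h a (by simp)).mul hr (ih fun i hi => h i (by simp [hi]))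

end NearPair

/-! ### Laurent monomials and series of them. -/

/-- The Laurent monomial `∏ tᵢ ^ eᵢ`. -/
noncomputable def laurentMonomial {ι K : Type*} [Fintype ι] [Field K] (e : ι → ℤ) (t : ι → K) : K :=
  ∏ i, t i ^ e i

/-- Multiplicativity in the exponent, zero values being allowed where both exponents are
nonnegative. -/
theorem laurentMonomial_add {ι K : Type*} [Fintype ι] [Field K] {e f : ι → ℤ} {t : ι → K}
    (h : ∀ i, t i ≠ 0 ∨ 0 ≤ e i ∧ 0 ≤ f i) :
    laurentMonomial (e + f) t = laurentMonomial e t * laurentMonomial f t := by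
  unfold laurentMonomial
  rw [← Finset.prod_mul_distrib]
  refine Finset.prod_congr rfl fun i _ => ?_
  rw [Pi.add_apply]
  refine zpow_add' ?_
  rcases h i with h | ⟨h1, h2⟩
  · exact Or.inl h
  · right; omega

/-- The partial derivatives of a Laurent monomial. -/
noncomputable def laurentMonomialPartial {ι K : Type*} [Fintype ι] [DecidableEq ι] [Field K]
    (e : ι → ℤ) (t : ι → K) (j : ι) : K :=
  (∏ i ∈ Finset.univ.erase j, t i ^ e i) * (e j * t j ^ (e j - 1))

theorem hasStrictFDerivAt_laurentMonomial {ι K : Type*} [Fintype ι] [DecidableEq ι]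
    [NontriviallyNormedField K] {e : ι → ℤ} {t : ι → K} (h : ∀ i, t i ≠ 0 ∨ 0 ≤ e i) :
    HasStrictFDerivAt (laurentMonomial e)
      (∑ j, laurentMonomialPartial e t j • (ContinuousLinearMap.proj j : (ι → K) →L[K] K)) t := by
  have h1 : ∀ i : ι, HasStrictFDerivAt (fun u : ι → K => u i ^ e i)
      ((e i * t i ^ (e i - 1)) • (ContinuousLinearMap.proj i : (ι → K) →L[K] K)) t := fun i =>
    (hasStrictDerivAt_zpow (e i) (t i) (h i)).comp_hasStrictFDerivAt t
      (ContinuousLinearMap.proj (R := K) (φ := fun _ : ι => K) i).hasStrictFDerivAt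
  have := HasStrictFDerivAt.finsetProd (u := Finset.univ)
    (g := fun (i : ι) (u : ι → K) => u i ^ e i) fun i _ => h1 i
  refine HasStrictFDerivAt.congr_fderiv (f := laurentMonomial e) this ?_
  refine Finset.sum_congr rfl fun j _ => ?_
  rw [smul_smul]; rfl

/-- The part of parameter space in which the theta series below converge: the two nomes have size
at most `r`, the other parameters are units. -/
def ThetaDomain {K : Type*} [NormedField K] (r : ℝ) (t : Fin 11 → K) : Prop :=
  ‖t 0‖ ≤ r ∧ ‖t 1‖ ≤ r ∧ ∀ i, 2 ≤ i → ‖t i‖ = 1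

theorem Fin.eq_zero_or_eq_one_or_two_le (i : Fin 11) : i = 0 ∨ i = 1 ∨ 2 ≤ i := by omega

theorem ThetaDomain.ne_zero {K : Type*} [NormedField K] {r : ℝ} {t : Fin 11 → K}
    (h : ThetaDomain r t) {i : Fin 11} (hi : 2 ≤ i) : t i ≠ 0 := by
  intro h0
  have := h.2.2 i hi
  simp [h0] at this

/-- Each nome factor contributes `r` to the constant and each unit factor `1`, whatever the sign of
its exponent. -/
theorem ThetaDomain.nearPair {K : Type*} [NormedField K] [IsUltrametricDist K] {r : ℝ}
    (hr : 0 ≤ r) (hr1 : r ≤ 1) {t u : Fin 11 → K} (ht : ThetaDomain r t) (hu : ThetaDomain r u)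
    {e : Fin 11 → ℤ} (h0 : 0 ≤ e 0) (h1 : 0 ≤ e 1) :
    NearPair r ‖t - u‖ (r ^ (e 0 + e 1).toNat) (laurentMonomial e t) (laurentMonomial e u) := by
  have hd := norm_nonneg (t - u)
  have hsub : ∀ i, ‖t i - u i‖ ≤ ‖t - u‖ := fun i => norm_le_pi_norm (t - u) i
  have key := NearPair.prod hr hd (Finset.univ : Finset (Fin 11))
    (C := fun i => if i = 0 then r ^ (e 0).toNat else if i = 1 then r ^ (e 1).toNat else 1)
    (f := fun i => t i ^ e i) (g := fun i => u i ^ e i) (by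
      intro i _
      rcases Fin.eq_zero_or_eq_one_or_two_le i with rfl | rfl | hi
      · have := (NearPair.of_norm_le hr ht.1 hu.1 (hsub 0)).pow hr hd (e 0).toNat
        rw [← zpow_natCast (t 0), ← zpow_natCast (u 0), Int.toNat_of_nonneg h0] at this
        simpa using this
      · have := (NearPair.of_norm_le hr ht.2.1 hu.2.1 (hsub 1)).pow hr hd (e 1).toNat
        rw [← zpow_natCast (t 1), ← zpow_natCast (u 1), Int.toNat_of_nonneg h1] at this
        simpa using this
      · have := NearPair.zpow_of_norm_eq_one hr hr1 (ht.2.2 i hi) (hu.2.2 i hi) (hsub i) (e i)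
        have hi0 : i ≠ 0 := by omega
        have hi1 : i ≠ 1 := by omega
        simpa [hi0, hi1] using this)
  have hprod : (∏ i : Fin 11, if i = 0 then r ^ (e 0).toNat else
      if i = 1 then r ^ (e 1).toNat else 1) = r ^ (e 0 + e 1).toNat := by
    rw [Int.toNat_add h0 h1, pow_add]
    simp [Fin.prod_univ_succ]
  rw [hprod] at key
  exact key

theorem ThetaDomain.norm_laurentMonomial_le {K : Type*} [NormedField K] [IsUltrametricDist K]
    {r : ℝ} (hr : 0 ≤ r) (hr1 : r ≤ 1) {t : Fin 11 → K} (ht : ThetaDomain r t)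
    {e : Fin 11 → ℤ} (h0 : 0 ≤ e 0) (h1 : 0 ≤ e 1) :
    ‖laurentMonomial e t‖ ≤ r ^ (e 0 + e 1).toNat :=
  (ht.nearPair hr hr1 ht h0 h1).left

/-- Passing from sizes to differences costs one power of `r`, so nome degree two still leaves the
Lipschitz constant `r`, which is as small as desired. -/
theorem ThetaDomain.norm_laurentMonomial_sub_le {K : Type*} [NormedField K] [IsUltrametricDist K]
    {r : ℝ} (hr : 0 < r) (hr1 : r ≤ 1) {t u : Fin 11 → K} (ht : ThetaDomain r t)
    (hu : ThetaDomain r u) {e : Fin 11 → ℤ} (h0 : 0 ≤ e 0) (h1 : 0 ≤ e 1) (h2 : 2 ≤ e 0 + e 1) :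
    ‖laurentMonomial e t - laurentMonomial e u‖ ≤ r * ‖t - u‖ := by
  have := (ht.nearPair hr.le hr1 hu h0 h1).sub
  obtain ⟨n, hn⟩ : ∃ n, (e 0 + e 1).toNat = n + 2 := ⟨(e 0 + e 1).toNat - 2, by omega⟩
  rw [hn] at this
  have h3 : r ^ (n + 2) * ‖t - u‖ ≤ (r * ‖t - u‖) * r := by
    have : r ^ n ≤ 1 := pow_le_one₀ hr.le hr1
    calc r ^ (n + 2) * ‖t - u‖ = r ^ n * ((r * ‖t - u‖) * r) := by ring
      _ ≤ 1 * ((r * ‖t - u‖) * r) := by gcongr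
      _ = _ := one_mul _
  exact le_of_mul_le_mul_right (this.trans h3) hr

/-- In a complete ultrametric field it suffices that the terms tend to zero, and the growth
hypothesis leaves only finitely many terms of bounded nome degree. -/
theorem summable_laurentMonomial {K : Type*} [NormedField K] [IsUltrametricDist K]
    [CompleteSpace K] {r : ℝ} (hr : 0 ≤ r) (hr1 : r < 1) {t : Fin 11 → K} (ht : ThetaDomain r t)
    {e : ℤ × ℤ → Fin 11 → ℤ} (h0 : ∀ μ, 0 ≤ e μ 0) (h1 : ∀ μ, 0 ≤ e μ 1)
    (h : ∀ μ, |μ.1| + |μ.2| - 2 ≤ e μ 0 + e μ 1) :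
    Summable fun μ => laurentMonomial (e μ) t := by
  refine NonarchimedeanAddGroup.summable_of_tendsto_cofinite_zero ?_
  rw [Metric.tendsto_nhds]
  intro ε hε
  obtain ⟨n, hn⟩ := exists_pow_lt_of_lt_one hε hr1
  have hfin : ((Finset.Icc (-(n + 2) : ℤ) (n + 2)) ×ˢ
      (Finset.Icc (-(n + 2) : ℤ) (n + 2)) : Set (ℤ × ℤ)).Finite :=
    Set.Finite.prod (Finset.finite_toSet _) (Finset.finite_toSet _)
  refine hfin.subset fun μ hμ => ?_
  simp only [Set.mem_compl_iff, Set.mem_ofPred_eq, dist_zero_right, not_lt] at hμ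
  have h2 := ht.norm_laurentMonomial_le hr hr1.le (h0 μ) (h1 μ)
  have h3 : (e μ 0 + e μ 1).toNat < n := by
    by_contra! hc
    exact absurd (hμ.trans (h2.trans (pow_le_pow_of_le_one hr hr1.le hc))) (not_le.mpr hn)
  have h4 := h μ
  have h5 := h0 μ
  have h6 := h1 μ
  simp only [Finset.coe_Icc, Set.mem_prod, Set.mem_Icc]
  have h7 := abs_le.mp (show |μ.1| ≤ n + 2 by have := abs_nonneg μ.2; omega)
  have h8 := abs_le.mp (show |μ.2| ≤ n + 2 by have := abs_nonneg μ.1; omega)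
  omega

/-- Termwise strict differentiation of a series over a complete ultrametric field. -/
theorem hasStrictFDerivAt_tsum_of_ultrametric {K E ι : Type*} [NontriviallyNormedField K]
    [IsUltrametricDist K] [CompleteSpace K] [NormedAddCommGroup E] [NormedSpace K E]
    {f : ι → E → K} {f' : ι → E →L[K] K} {x : E} (S : Finset ι)
    (hS : ∀ i ∈ S, HasStrictFDerivAt (f i) (f' i) x)
    (hsum : ∀ᶠ y in 𝓝 x, Summable fun i => f i y)
    (hlip : ∀ ε > 0, ∀ᶠ y in 𝓝 (x, x), ∀ i ∉ S, ‖f i y.1 - f i y.2‖ ≤ ε * ‖y.1 - y.2‖) :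
    HasStrictFDerivAt (fun y => ∑' i, f i y) (∑ i ∈ S, f' i) x := by
  classical
  have hmain : HasStrictFDerivAt (fun y => ∑ i ∈ S, f i y) (∑ i ∈ S, f' i) x :=
    HasStrictFDerivAt.fun_sum hS
  refine .of_isLittleO ?_
  rw [Asymptotics.isLittleO_iff]
  intro ε hε
  have h1 := (Asymptotics.isLittleO_iff.mp hmain.isLittleO) (half_pos hε)
  have h2 := hlip (ε / 2) (half_pos hε)
  have h3 : ∀ᶠ y in 𝓝 (x, x), Summable (fun i => f i y.1) ∧ Summable (fun i => f i y.2) := by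
    rw [nhds_prod_eq]
    exact hsum.prod_mk hsum
  filter_upwards [h1, h2, h3] with y h1 h2 ⟨h3, h4⟩
  have e1 := h3.sum_add_tsum_subtype_compl S
  have e2 := h4.sum_add_tsum_subtype_compl S
  have h5 : ‖(∑' i : { i // i ∉ S }, f i y.1) - ∑' i : { i // i ∉ S }, f i y.2‖ ≤
      ε / 2 * ‖y.1 - y.2‖ := by
    have s1 : Summable fun i : { i // i ∉ S } => f i y.1 := h3.subtype _
    have s2 : Summable fun i : { i // i ∉ S } => f i y.2 := h4.subtype _
    rw [← s1.tsum_sub s2]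
    refine le_of_tendsto (s1.sub s2).hasSum.norm (Eventually.of_forall fun T => ?_)
    exact IsUltrametricDist.norm_sum_le_of_forall_le_of_nonneg (by positivity)
      fun i _ => h2 i i.2
  calc _ = ‖((∑ i ∈ S, f i y.1) - (∑ i ∈ S, f i y.2) - (∑ i ∈ S, f' i) (y.1 - y.2)) +
        ((∑' i : { i // i ∉ S }, f i y.1) - ∑' i : { i // i ∉ S }, f i y.2)‖ := by
        rw [← e1, ← e2]; congr 1; ring
    _ ≤ _ := norm_add_le _ _
    _ ≤ ε / 2 * ‖y.1 - y.2‖ + ε / 2 * ‖y.1 - y.2‖ := add_le_add h1 h5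
    _ = _ := by ring

/-! ### Theta sequences and their addition formula. -/

/-- The exponents of the term `μ` of the two-dimensional theta series at position `p`: the
parameters are two nomes, the interaction, two amplitudes, two multipliers and the four gauge
parameters. -/
def thetaExponent (p : ℤ) (μ : ℤ × ℤ) : Fin 11 → ℤ :=
  ![μ.1 * (μ.1 - 1) / 2, μ.2 * (μ.2 - 1) / 2, μ.1 * μ.2, μ.1, μ.2, p * μ.1, p * μ.2, 1, p % 2, p,
    p ^ 2]

/-- The sequence given by a two-dimensional theta series along an arithmetic progression of
arguments, up to gauge factors. -/
noncomputable def thetaSeq {K : Type*} [NormedField K] (p : ℤ) (t : Fin 11 → K) : K :=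
  ∑' μ, laurentMonomial (thetaExponent p μ) t

theorem two_mul_mul_sub_one_ediv_two (m : ℤ) : 2 * (m * (m - 1) / 2) = m * (m - 1) :=
  Int.mul_ediv_cancel' (even_iff_two_dvd.mp (Int.even_mul_pred_self m))

theorem abs_sub_one_le_mul_sub_one_ediv_two (m : ℤ) : |m| - 1 ≤ m * (m - 1) / 2 := by
  have h := two_mul_mul_sub_one_ediv_two m
  rcases abs_cases m with ⟨h1, h2⟩ | ⟨h1, h2⟩ <;> rw [h1]
  · rcases le_or_gt m 0 with h3 | h3
    · have : m = 0 := le_antisymm h3 h2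
      subst this; simp
    · rcases le_or_gt m 1 with h4 | h4 <;> nlinarith
  · nlinarith

theorem mul_sub_one_ediv_two_nonneg (m : ℤ) : 0 ≤ m * (m - 1) / 2 := by
  have h := two_mul_mul_sub_one_ediv_two m
  rcases le_or_gt m 0 with h3 | h3 <;> nlinarith

theorem summable_thetaSeq {K : Type*} [NormedField K] [IsUltrametricDist K] [CompleteSpace K]
    {r : ℝ} (hr : 0 ≤ r) (hr1 : r < 1) {t : Fin 11 → K} (ht : ThetaDomain r t) (p : ℤ) :
    Summable fun μ => laurentMonomial (thetaExponent p μ) t := by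
  refine summable_laurentMonomial hr hr1 ht (fun μ => mul_sub_one_ediv_two_nonneg μ.1)
    (fun μ => mul_sub_one_ediv_two_nonneg μ.2) fun μ => ?_
  have h1 := abs_sub_one_le_mul_sub_one_ediv_two μ.1
  have h2 := abs_sub_one_le_mul_sub_one_ediv_two μ.2
  simp only [thetaExponent, Matrix.cons_val_zero, Matrix.cons_val_one]
  linarith

/-- The change of summation indices `(κ, l, j) ↦ (l - j, l + j + κ)` of the addition formula. -/
def thetaReindex : (Fin 2 × Fin 2) × (ℤ × ℤ) × (ℤ × ℤ) ≃ (ℤ × ℤ) × (ℤ × ℤ) where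
  toFun x := ((x.2.1.1 - x.2.2.1, x.2.1.2 - x.2.2.2),
    (x.2.1.1 + x.2.2.1 + (x.1.1 : ℕ), x.2.1.2 + x.2.2.2 + (x.1.2 : ℕ)))
  invFun y := ((⟨((y.1.1 + y.2.1) % 2).toNat, by omega⟩, ⟨((y.1.2 + y.2.2) % 2).toNat, by omega⟩),
    ((y.1.1 + y.2.1) / 2, (y.1.2 + y.2.2) / 2), ((y.2.1 - y.1.1) / 2, (y.2.2 - y.1.2) / 2))
  left_inv := by
    rintro ⟨⟨⟨k1, hk1⟩, ⟨k2, hk2⟩⟩, ⟨l1, l2⟩, ⟨j1, j2⟩⟩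
    simp only [Prod.mk.injEq, Fin.mk.injEq]
    omega
  right_inv := by
    rintro ⟨⟨a, b⟩, ⟨c, d⟩⟩
    simp only [Prod.mk.injEq]
    omega

/-- The row factor of the addition formula. -/
def thetaRowExponent (m P : ℤ) (κ : Fin 2 × Fin 2) (l : ℤ × ℤ) : Fin 11 → ℤ :=
  ![l.1 * (l.1 + (κ.1 : ℕ) - 1), l.2 * (l.2 + (κ.2 : ℕ) - 1),
    2 * l.1 * l.2 + l.1 * (κ.2 : ℕ) + (κ.1 : ℕ) * l.2, 2 * l.1 + (κ.1 : ℕ), 2 * l.2 + (κ.2 : ℕ),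
    P * (2 * l.1 + (κ.1 : ℕ)) + m * l.1, P * (2 * l.2 + (κ.2 : ℕ)) + m * l.2, 2,
    if Even m then 2 * (P % 2) else 1, 2 * P + m, 2 * P ^ 2 + 2 * P * m]

/-- The column factor of the addition formula. -/
def thetaColExponent (m c : ℤ) (κ : Fin 2 × Fin 2) (j : ℤ × ℤ) : Fin 11 → ℤ :=
  ![j.1 * (j.1 + (κ.1 : ℕ)), j.2 * (j.2 + (κ.2 : ℕ)),
    2 * j.1 * j.2 + j.1 * (κ.2 : ℕ) + (κ.1 : ℕ) * j.2 + (κ.1 : ℕ) * (κ.2 : ℕ), 0, 0,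
    m * (j.1 + (κ.1 : ℕ)) - c * (2 * j.1 + (κ.1 : ℕ)),
    m * (j.2 + (κ.2 : ℕ)) - c * (2 * j.2 + (κ.2 : ℕ)), 0, 0, 0, c ^ 2 + (m - c) ^ 2]

/-- By the parallelogram identity the cross terms between `l` and `j`, and between `P` and `c`,
cancel in all quadratic exponents. The parity gauge exponent `p % 2` is the only entry that needs
`h`. -/
theorem thetaExponent_add (m P c : ℤ) (h : Odd m ∨ Even m ∧ Even c) (κ : Fin 2 × Fin 2)
    (l j : ℤ × ℤ) :
    thetaExponent (P + c) (thetaReindex (κ, l, j)).1 +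
      thetaExponent (P + m - c) (thetaReindex (κ, l, j)).2 =
      thetaRowExponent m P κ l + thetaColExponent m c κ j := by
  have hT : ∀ (k : Fin 2) (a b : ℤ), (a - b) * (a - b - 1) / 2 +
      (a + b + (k : ℕ)) * (a + b + (k : ℕ) - 1) / 2 =
      a * (a + (k : ℕ) - 1) + b * (b + (k : ℕ)) := by
    intro k a b
    have h1 := two_mul_mul_sub_one_ediv_two (a - b)
    have h2 := two_mul_mul_sub_one_ediv_two (a + b + (k : ℕ))
    have hk : (((k : ℕ) : ℤ)) * (((k : ℕ) : ℤ) - 1) = 0 := by fin_cases k <;> simp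
    refine mul_left_cancel₀ (two_ne_zero (α := ℤ)) ?_
    linear_combination h1 + h2 + hk
  funext i
  obtain ⟨κ1, κ2⟩ := κ
  obtain ⟨l1, l2⟩ := l
  obtain ⟨j1, j2⟩ := j
  fin_cases i <;> simp [thetaExponent, thetaRowExponent, thetaColExponent, thetaReindex, hT] <;>
    try ring1
  split_ifs with hm
  · rcases h with h | ⟨-, h⟩
    · exact absurd hm (Int.not_even_iff_odd.mpr h)
    · obtain ⟨a, rfl⟩ := hm
      obtain ⟨b, rfl⟩ := h
      omega
  · obtain ⟨a, rfl⟩ := Int.not_even_iff_odd.mp hm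
    omega

theorem Int.abs_sub_one_le_mul_add {j : ℤ} (k : Fin 2) : |j| - 1 ≤ j * (j + (k : ℕ)) ∧
    0 ≤ j * (j + (k : ℕ)) ∧ |j| - 1 ≤ j * (j + (k : ℕ) - 1) ∧ 0 ≤ j * (j + (k : ℕ) - 1) := by
  have h0 : j ≤ -1 ∨ j = 0 ∨ 1 ≤ j := by omega
  rcases h0 with h | rfl | h
  · rw [abs_of_neg (by omega)]
    fin_cases k <;> simp <;> refine ⟨?_, ?_, ?_, ?_⟩ <;> nlinarith
  · simp
  · rw [abs_of_pos (by omega)]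
    fin_cases k <;> simp <;> refine ⟨?_, ?_, ?_, ?_⟩ <;> nlinarith

/-- The addition formula: for a fixed sum of positions, the products of two terms of a theta
sequence form a matrix of rank at most four. -/
theorem exists_thetaSeq_mul_eq_sum {K : Type*} [NormedField K] [IsUltrametricDist K]
    [CompleteSpace K] {r : ℝ} (hr : 0 ≤ r) (hr1 : r < 1) {t : Fin 11 → K} (ht : ThetaDomain r t)
    (m : ℤ) : ∃ X Y : ℤ → Fin 2 × Fin 2 → K, ∀ P c : ℤ, (Odd m ∨ Even m ∧ Even c) →
      thetaSeq (P + c) t * thetaSeq (P + m - c) t = ∑ κ, X P κ * Y c κ := by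
  refine ⟨fun P κ => ∑' l, laurentMonomial (thetaRowExponent m P κ l) t,
    fun c κ => ∑' j, laurentMonomial (thetaColExponent m c κ j) t, fun P c h => ?_⟩
  have : NonarchimedeanRing K := ⟨NonarchimedeanAddGroup.is_nonarchimedean⟩
  have hP := summable_thetaSeq hr hr1 ht (P + c)
  have hQ := summable_thetaSeq hr hr1 ht (P + m - c)
  have hX : ∀ κ, Summable fun l => laurentMonomial (thetaRowExponent m P κ l) t := fun κ => by
    refine summable_laurentMonomial hr hr1 ht
      (fun l => (Int.abs_sub_one_le_mul_add (j := l.1) κ.1).2.2.2)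
      (fun l => (Int.abs_sub_one_le_mul_add (j := l.2) κ.2).2.2.2) fun l => ?_
    have h1 := (Int.abs_sub_one_le_mul_add (j := l.1) κ.1).2.2.1
    have h2 := (Int.abs_sub_one_le_mul_add (j := l.2) κ.2).2.2.1
    simp only [thetaRowExponent, Matrix.cons_val_zero, Matrix.cons_val_one]
    linarith
  have hY : ∀ κ, Summable fun j => laurentMonomial (thetaColExponent m c κ j) t := fun κ => by
    refine summable_laurentMonomial hr hr1 ht
      (fun j => (Int.abs_sub_one_le_mul_add (j := j.1) κ.1).2.1)
      (fun j => (Int.abs_sub_one_le_mul_add (j := j.2) κ.2).2.1) fun j => ?_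
    have h1 := (Int.abs_sub_one_le_mul_add (j := j.1) κ.1).1
    have h2 := (Int.abs_sub_one_le_mul_add (j := j.2) κ.2).1
    simp only [thetaColExponent, Matrix.cons_val_zero, Matrix.cons_val_one]
    linarith
  have hsum := (hP.mul_of_nonarchimedean hQ)
  unfold thetaSeq
  rw [tsum_mul_tsum_of_nonarchimedean hP hQ, ← thetaReindex.tsum_eq]
  have hterm : ∀ x : (Fin 2 × Fin 2) × (ℤ × ℤ) × (ℤ × ℤ),
      laurentMonomial (thetaExponent (P + c) (thetaReindex x).1) t *
        laurentMonomial (thetaExponent (P + m - c) (thetaReindex x).2) t =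
      laurentMonomial (thetaRowExponent m P x.1 x.2.1) t *
        laurentMonomial (thetaColExponent m c x.1 x.2.2) t := by
    rintro ⟨κ, l, j⟩
    rw [← laurentMonomial_add, ← laurentMonomial_add, thetaExponent_add m P c h]
    · intro i
      rcases Fin.eq_zero_or_eq_one_or_two_le i with rfl | rfl | hi
      · exact Or.inr ⟨(Int.abs_sub_one_le_mul_add (j := l.1) κ.1).2.2.2,
          (Int.abs_sub_one_le_mul_add (j := j.1) κ.1).2.1⟩
      · exact Or.inr ⟨(Int.abs_sub_one_le_mul_add (j := l.2) κ.2).2.2.2,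
          (Int.abs_sub_one_le_mul_add (j := j.2) κ.2).2.1⟩
      · exact Or.inl (ht.ne_zero hi)
    · intro i
      rcases Fin.eq_zero_or_eq_one_or_two_le i with rfl | rfl | hi
      · exact Or.inr ⟨mul_sub_one_ediv_two_nonneg _, mul_sub_one_ediv_two_nonneg _⟩
      · exact Or.inr ⟨mul_sub_one_ediv_two_nonneg _, mul_sub_one_ediv_two_nonneg _⟩
      · exact Or.inl (ht.ne_zero hi)
  have hsum' : Summable fun x : (Fin 2 × Fin 2) × (ℤ × ℤ) × (ℤ × ℤ) =>
      laurentMonomial (thetaRowExponent m P x.1 x.2.1) t *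
        laurentMonomial (thetaColExponent m c x.1 x.2.2) t := by
    refine (thetaReindex.summable_iff.mpr hsum).congr fun x => ?_
    exact hterm x
  simp_rw [hterm]
  rw [hsum'.tsum_prod, tsum_fintype]
  exact Finset.sum_congr rfl fun κ _ => (tsum_mul_tsum_of_nonarchimedean (hX κ) (hY κ)).symm

/-! ### Strict differentiability at vanishing nomes. -/

/-- The indices of the terms of a theta series that are at most linear in the nomes. -/
noncomputable def thetaLowIndices : Finset (ℤ × ℤ) := Finset.Icc (-1) 2 ×ˢ Finset.Icc (-1) 2

theorem two_le_thetaExponent_of_notMem {μ : ℤ × ℤ} (h : μ ∉ thetaLowIndices) (p : ℤ) :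
    2 ≤ thetaExponent p μ 0 + thetaExponent p μ 1 := by
  have h1 := mul_sub_one_ediv_two_nonneg μ.1
  have h2 := mul_sub_one_ediv_two_nonneg μ.2
  have h3 := two_mul_mul_sub_one_ediv_two μ.1
  have h4 := two_mul_mul_sub_one_ediv_two μ.2
  simp only [thetaLowIndices, Finset.mem_product, Finset.mem_Icc] at h
  simp only [thetaExponent, Matrix.cons_val_zero, Matrix.cons_val_one]
  have h5 : μ.1 ≤ -2 ∨ 3 ≤ μ.1 ∨ μ.2 ≤ -2 ∨ 3 ≤ μ.2 := by omega
  rcases h5 with h | h | h | h <;> nlinarith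

/-- The ultrametric norm is locally constant away from zero, so parameters of norm one keep it under
perturbations of size less than one. -/
theorem eventually_thetaDomain {K : Type*} [NormedField K] [IsUltrametricDist K]
    {t₀ : Fin 11 → K} (h0 : t₀ 0 = 0) (h1 : t₀ 1 = 0) (h2 : ∀ i, 2 ≤ i → ‖t₀ i‖ = 1) {r : ℝ}
    (hr : 0 < r) : ∀ᶠ t in 𝓝 t₀, ThetaDomain r t := by
  filter_upwards [Metric.ball_mem_nhds t₀ (lt_min hr one_pos)] with t ht
  have h : ∀ i, ‖t i - t₀ i‖ < min r 1 := fun i => by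
    rw [Metric.mem_ball, dist_eq_norm] at ht
    exact (norm_le_pi_norm (t - t₀) i).trans_lt ht
  refine ⟨?_, ?_, fun i hi => ?_⟩
  · simpa [h0] using ((h 0).trans_le (min_le_left _ _)).le
  · simpa [h1] using ((h 1).trans_le (min_le_left _ _)).le
  · have h3 := (h i).trans_le (min_le_right r 1)
    rw [← h2 i hi] at h3 ⊢
    by_contra hne
    have h4 := IsUltrametricDist.norm_add_eq_max_of_norm_ne_norm (x := t i) (y := -t₀ i)
      (by rwa [norm_neg])
    rw [← sub_eq_add_neg, norm_neg] at h4
    exact absurd (le_max_right ‖t i‖ ‖t₀ i‖) (not_le.mpr (h4 ▸ h3))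

/-- Where both nomes have size at most `ε`, every term of nome degree at least two is `ε`-Lipschitz;
only the finite block of low indices affects the derivative. -/
theorem hasStrictFDerivAt_thetaSeq {K : Type*} [NontriviallyNormedField K] [IsUltrametricDist K]
    [CompleteSpace K] {t₀ : Fin 11 → K} (h0 : t₀ 0 = 0) (h1 : t₀ 1 = 0)
    (h2 : ∀ i, 2 ≤ i → ‖t₀ i‖ = 1) (p : ℤ) :
    HasStrictFDerivAt (thetaSeq p)
      (∑ μ ∈ thetaLowIndices, ∑ j, laurentMonomialPartial (thetaExponent p μ) t₀ j •
        (ContinuousLinearMap.proj j : (Fin 11 → K) →L[K] K)) t₀ := by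
  refine hasStrictFDerivAt_tsum_of_ultrametric (f := fun μ => laurentMonomial (thetaExponent p μ))
    thetaLowIndices (fun μ _ => hasStrictFDerivAt_laurentMonomial fun i => ?_) ?_ ?_
  · rcases Fin.eq_zero_or_eq_one_or_two_le i with rfl | rfl | hi
    · exact Or.inr (mul_sub_one_ediv_two_nonneg _)
    · exact Or.inr (mul_sub_one_ediv_two_nonneg _)
    · left
      intro h
      have := h2 i hi
      simp [h] at this
  · filter_upwards [eventually_thetaDomain h0 h1 h2 one_half_pos] with t ht
    exact summable_thetaSeq (by norm_num) (by norm_num) ht p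
  · intro ε hε
    have hr : 0 < min ε 1 := lt_min hε one_pos
    have := eventually_thetaDomain h0 h1 h2 hr
    rw [nhds_prod_eq]
    filter_upwards [this.prod_mk this] with y hy μ hμ
    refine (hy.1.norm_laurentMonomial_sub_le hr (min_le_right _ _) hy.2
      (mul_sub_one_ediv_two_nonneg _) (mul_sub_one_ediv_two_nonneg _)
      (two_le_thetaExponent_of_notMem hμ p)).trans ?_
    gcongr
    exact min_le_left _ _

/-- At vanishing nomes a theta sequence is a two-soliton sequence. -/
theorem thetaSeq_eq_of_nome_eq_zero {K : Type*} [NormedField K]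
    {t : Fin 11 → K} (h0 : t 0 = 0) (h1 : t 1 = 0) (p : ℤ) :
    thetaSeq p t = (1 + t 3 * t 5 ^ p + t 4 * t 6 ^ p +
      t 2 * t 3 * t 4 * t 5 ^ p * t 6 ^ p) * (t 7 * t 8 ^ (p % 2) * t 9 ^ p * t 10 ^ p ^ 2) := by
  have hT : ∀ m : ℤ, m ∉ Finset.Icc (0 : ℤ) 1 → m * (m - 1) / 2 ≠ 0 := by
    intro m hm h
    have h3 := two_mul_mul_sub_one_ediv_two m
    rw [h] at h3
    rcases mul_eq_zero.mp (h3.symm.trans (mul_zero 2)) with h4 | h4 <;>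
      exact hm (by simp only [Finset.mem_Icc]; omega)
  have : ∀ μ ∉ (Finset.Icc (0 : ℤ) 1 ×ˢ Finset.Icc (0 : ℤ) 1),
      laurentMonomial (thetaExponent p μ) t = 0 := by
    intro μ hμ
    simp only [Finset.mem_product, not_and_or] at hμ
    rcases hμ with h | h
    · refine Finset.prod_eq_zero (Finset.mem_univ 0) ?_
      rw [h0]; exact zero_zpow _ (hT _ h)
    · refine Finset.prod_eq_zero (Finset.mem_univ 1) ?_
      rw [h1]; exact zero_zpow _ (hT _ h)
  rw [thetaSeq, tsum_eq_sum this]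
  have : (Finset.Icc (0 : ℤ) 1 ×ˢ Finset.Icc (0 : ℤ) 1) = {(0, 0), (0, 1), (1, 0), (1, 1)} := by
    decide
  rw [this]
  simp [laurentMonomial, thetaExponent, Fin.prod_univ_succ]
  ring

/-! ### Somos terms as rational functions of the data, and transfer between fields. -/

/-- The sequence generated by the order-7 Somos recurrence
`sₙsₙ₊₇ + w₇sₙ₊₁sₙ₊₆ + w₈sₙ₊₂sₙ₊₅ + w₉sₙ₊₃sₙ₊₄ = 0` from the seed `w₀, …, w₆`. -/
def somosSeven {F : Type*} [Field F] (w : Fin 10 → F) (n : ℕ) : F :=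
  if h : n < 7 then w ⟨n, by omega⟩
  else -(w 7 * somosSeven w (n - 6) * somosSeven w (n - 1) +
    w 8 * somosSeven w (n - 5) * somosSeven w (n - 2) +
    w 9 * somosSeven w (n - 4) * somosSeven w (n - 3)) / somosSeven w (n - 7)
termination_by n

section somosSeven
variable {F : Type*} [Field F] (w : Fin 10 → F)

theorem somosSeven_of_lt {n : ℕ} (h : n < 7) : somosSeven w n = w ⟨n, by omega⟩ := by
  rw [somosSeven, dif_pos h]

theorem somosSeven_add_seven (n : ℕ) : somosSeven w (n + 7) =
    -(w 7 * somosSeven w (n + 1) * somosSeven w (n + 6) +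
      w 8 * somosSeven w (n + 2) * somosSeven w (n + 5) +
      w 9 * somosSeven w (n + 3) * somosSeven w (n + 4)) / somosSeven w n := by
  rw [somosSeven, dif_neg (by omega)]
  rfl

theorem somosSeven_relation {n : ℕ} (h : somosSeven w n ≠ 0) :
    somosSeven w n * somosSeven w (n + 7) + w 7 * somosSeven w (n + 1) * somosSeven w (n + 6) +
      w 8 * somosSeven w (n + 2) * somosSeven w (n + 5) +
      w 9 * somosSeven w (n + 3) * somosSeven w (n + 4) = 0 := by
  rw [somosSeven_add_seven, mul_div_cancel₀ _ h]
  ring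

theorem eq_somosSeven {s : ℕ → F} {L : ℕ} (hseed : ∀ n (h : n < 7), s n = w ⟨n, by omega⟩)
    (h0 : ∀ n ≤ L, s n ≠ 0)
    (hrel : ∀ n, n + 7 ≤ L → s n * s (n + 7) + w 7 * s (n + 1) * s (n + 6) +
      w 8 * s (n + 2) * s (n + 5) + w 9 * s (n + 3) * s (n + 4) = 0) :
    ∀ n ≤ L, s n = somosSeven w n := by
  intro n
  induction n using Nat.strong_induction_on with
  | _ n ih =>
    intro hn
    rcases lt_or_ge n 7 with h | h
    · rw [hseed n h, somosSeven_of_lt w h]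
    · obtain ⟨k, rfl⟩ := Nat.exists_eq_add_of_le' h
      rw [somosSeven_add_seven, ← ih k (by omega) (by omega), ← ih (k + 1) (by omega) (by omega),
        ← ih (k + 2) (by omega) (by omega), ← ih (k + 3) (by omega) (by omega),
        ← ih (k + 4) (by omega) (by omega), ← ih (k + 5) (by omega) (by omega),
        ← ih (k + 6) (by omega) (by omega), eq_div_iff (h0 k (by omega))]
      linear_combination hrel k hn

end somosSeven

/-- Over every field, the terms of a Somos sequence of order 7 are quotients of integral polynomials
in its seed and coefficients, with a common denominator that does not vanish as long as the
preceding terms do not. -/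
theorem exists_somosSeven_numerators (L : ℕ) :
    ∃ (D : MvPolynomial (Fin 10) ℤ) (N : ℕ → MvPolynomial (Fin 10) ℤ),
      ∀ (F : Type) [Field F] (w : Fin 10 → F), (∀ n < L, somosSeven w n ≠ 0) →
        MvPolynomial.aeval w D ≠ 0 ∧
        ∀ n ≤ L, somosSeven w n * MvPolynomial.aeval w D = MvPolynomial.aeval w (N n) := by
  induction L with
  | zero =>
    refine ⟨1, fun _ => MvPolynomial.X 0, fun F _ w _ => ⟨by simp, fun n hn => ?_⟩⟩
    obtain rfl : n = 0 := by omega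
    simp [somosSeven_of_lt]
  | succ L ih =>
    obtain ⟨D, N, h⟩ := ih
    rcases lt_or_ge (L + 1) 7 with hL | hL
    · refine ⟨D, fun n => if n ≤ L then N n else MvPolynomial.X ⟨L + 1, by omega⟩ * D,
        fun F _ w hw => ?_⟩
      obtain ⟨h1, h2⟩ := h F w fun n hn => hw n (by omega)
      refine ⟨h1, fun n hn => ?_⟩
      beta_reduce
      split_ifs with hnL
      · exact h2 n hnL
      · obtain rfl : n = L + 1 := by omega
        simp [somosSeven_of_lt w hL]
    · obtain ⟨k, hk⟩ := Nat.exists_eq_add_of_le' hL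
      -- The new term is a quotient by term `k`, whose cleared form is `N k`; this is the extra
      -- factor of the denominator.
      refine ⟨D * N k, fun n => if n ≤ L then N n * N k else
        -(MvPolynomial.X 7 * N (k + 1) * N (k + 6) + MvPolynomial.X 8 * N (k + 2) * N (k + 5) +
          MvPolynomial.X 9 * N (k + 3) * N (k + 4)), fun F _ w hw => ?_⟩
      obtain ⟨h1, h2⟩ := h F w fun n hn => hw n (by omega)
      have hk0 : somosSeven w k ≠ 0 := hw k (by omega)
      have hNk : MvPolynomial.aeval w (N k) ≠ 0 := by
        rw [← h2 k (by omega)]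
        exact mul_ne_zero hk0 h1
      refine ⟨by simpa using ⟨h1, hNk⟩, fun n hn => ?_⟩
      beta_reduce
      split_ifs with hnL
      · rw [map_mul, map_mul, ← h2 n hnL]; ring
      · obtain rfl : n = k + 7 := by omega
        simp only [map_neg, map_add, map_mul, MvPolynomial.aeval_X]
        rw [← h2 k (by omega), ← h2 (k + 1) (by omega), ← h2 (k + 2) (by omega),
          ← h2 (k + 3) (by omega), ← h2 (k + 4) (by omega), ← h2 (k + 5) (by omega),
          ← h2 (k + 6) (by omega), somosSeven_add_seven]
        field_simp

/-- The seed and coefficients of the unit Somos sequence of order 7. -/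
def unitSomosData (F : Type*) [Field F] (i : Fin 10) : F := if i < 7 then 1 else -1

theorem somosSeven_unit_pos {F : Type*} [Field F] [LinearOrder F] [IsStrictOrderedRing F] (n : ℕ) :
    0 < somosSeven (unitSomosData F) n := by
  induction n using Nat.strong_induction_on with
  | _ n ih =>
    rcases lt_or_ge n 7 with h | h
    · rw [somosSeven_of_lt _ h, unitSomosData, if_pos (by simpa [Fin.lt_def] using h)]
      exact one_pos
    · obtain ⟨k, rfl⟩ := Nat.exists_eq_add_of_le' h
      rw [somosSeven_add_seven]
      have h7 : unitSomosData F 7 = -1 := if_neg (by decide)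
      have h8 : unitSomosData F 8 = -1 := if_neg (by decide)
      have h9 : unitSomosData F 9 = -1 := if_neg (by decide)
      have e1 := ih (k + 1) (by omega)
      have e2 := ih (k + 2) (by omega)
      have e3 := ih (k + 3) (by omega)
      have e4 := ih (k + 4) (by omega)
      have e5 := ih (k + 5) (by omega)
      have e6 := ih (k + 6) (by omega)
      refine div_pos ?_ (ih k (by omega))
      rw [h7, h8, h9]
      have := mul_pos e1 e6
      have := mul_pos e2 e5
      have := mul_pos e3 e4
      linarith

theorem MvPolynomial.eq_zero_of_eventually_aeval_eq_zero {K σ : Type*} [Finite σ]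
    [NontriviallyNormedField K] [CharZero K] {Q : MvPolynomial σ ℤ} {w₀ : σ → K}
    (h : ∀ᶠ w in 𝓝 w₀, MvPolynomial.aeval w Q = 0) : Q = 0 := by
  have := Fintype.ofFinite σ
  obtain ⟨ε, hε, hball⟩ := Metric.eventually_nhds_iff_ball.mp h
  have hinf : ∀ i : σ, (Metric.ball (w₀ i) ε).Infinite := fun i =>
    infinite_of_mem_nhds (w₀ i) (Metric.ball_mem_nhds _ hε)
  refine MvPolynomial.map_injective (Int.castRingHom K) Int.cast_injective ?_
  rw [map_zero]
  refine MvPolynomial.funext_set (fun i => Metric.ball (w₀ i) ε) hinf fun x hx => ?_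
  rw [MvPolynomial.eval_map, map_zero]
  refine hball x ?_
  rw [ball_pi _ hε]
  exact hx

/-- The vanishing of determinants of products of two terms carries over from the order-7 Somos
sequences with data near a given point to all those with nonzero terms over all fields. -/
theorem det_somosSeven_eq_zero_of_eventually {K : Type} [NontriviallyNormedField K] [CharZero K]
    {w₀ : Fin 10 → K} {ι : Type*} [Fintype ι] [DecidableEq ι] (A B : ι → ι → ℕ) (L M : ℕ)
    (h : ∀ᶠ w in 𝓝 w₀, (∀ n ≤ M, somosSeven w n ≠ 0) →
      (Matrix.of fun i j => somosSeven w (A i j) * somosSeven w (B i j)).det = 0)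
    (hLM : L ≤ M) (hA : ∀ i j, A i j ≤ L) (hB : ∀ i j, B i j ≤ L) {F : Type} [Field F]
    (w : Fin 10 → F) (hw : ∀ n ≤ L, somosSeven w n ≠ 0) :
    (Matrix.of fun i j => somosSeven w (A i j) * somosSeven w (B i j)).det = 0 := by
  choose D N hDN using exists_somosSeven_numerators
  set Δ : MvPolynomial (Fin 10) ℤ :=
    (Matrix.of fun i j => N L (A i j) * N L (B i j)).det with hΔ
  have hdet : ∀ (F : Type) [Field F] (w : Fin 10 → F), (∀ n < L, somosSeven w n ≠ 0) →
      MvPolynomial.aeval w Δ =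
        ((MvPolynomial.aeval w (D L)) ^ 2) ^ Fintype.card ι *
          (Matrix.of fun i j => somosSeven w (A i j) * somosSeven w (B i j)).det := by
    intro F _ w hw
    rw [hΔ, AlgHom.map_det, ← Matrix.det_smul]
    congr 1
    ext i j
    simp only [AlgHom.mapMatrix_apply, Matrix.map_apply, Matrix.of_apply, map_mul,
      Matrix.smul_apply, smul_eq_mul]
    rw [← (hDN L F w hw).2 _ (hA i j), ← (hDN L F w hw).2 _ (hB i j)]
    ring
  -- The unit sequence over `ℚ` is positive, which witnesses that these numerators are not the zero
  -- polynomial.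
  have hN : ∀ n, N n n ≠ 0 := by
    intro n hn
    have h1 := hDN n ℚ (unitSomosData ℚ) fun k _ => (somosSeven_unit_pos k).ne'
    have h2 := h1.2 n le_rfl
    rw [hn, map_zero] at h2
    exact mul_ne_zero (somosSeven_unit_pos n).ne' h1.1 h2
  -- Near `w₀` some factor always vanishes: `Δ` if all terms up to `M` are nonzero, otherwise `N n
  -- n` at the first vanishing term. The polynomial ring being a domain, `Δ` itself is zero.
  have hprod : Δ * ∏ n ∈ Finset.range (M + 1), N n n = 0 := by
    refine MvPolynomial.eq_zero_of_eventually_aeval_eq_zero (w₀ := w₀) ?_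
    filter_upwards [h] with w hw
    rw [map_mul, map_prod]
    by_cases h0 : ∀ n ≤ M, somosSeven w n ≠ 0
    · rw [hdet K w fun n hn => h0 n (by omega), hw h0, mul_zero, zero_mul]
    · push Not at h0
      classical
      have hmin := fun k => @Nat.find_min _ _ h0 k
      obtain ⟨h1, h2⟩ := Nat.find_spec h0
      set n := Nat.find h0
      have h3 := (hDN n K w fun k hk hk0 => hmin k hk ⟨by omega, hk0⟩).2 n le_rfl
      rw [h2, zero_mul] at h3
      rw [Finset.prod_eq_zero (Finset.mem_range.mpr (Nat.lt_succ_of_le h1)) h3.symm, mul_zero]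
  have hΔ0 : Δ = 0 := (mul_eq_zero.mp hprod).resolve_right
    (Finset.prod_ne_zero_iff.mpr fun n _ => hN n)
  have h1 := hdet F w fun n hn => hw n hn.le
  rw [hΔ0, map_zero] at h1
  exact (mul_eq_zero.mp h1.symm).resolve_left
    (pow_ne_zero _ (pow_ne_zero _ (hDN L F w fun n hn => hw n hn.le).1))

/-! ### The Jacobian at the two-soliton point. -/

theorem laurentMonomialPartial_eq_prod {ι K : Type*} [Fintype ι] [DecidableEq ι] [Field K]
    (e : ι → ℤ) (t : ι → K) (j : ι) : laurentMonomialPartial e t j =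
      ∏ i, if i = j then e j * t j ^ (e j - 1) else t i ^ e i := by
  rw [laurentMonomialPartial, mul_comm, ← Finset.mul_prod_erase _ _ (Finset.mem_univ j), if_pos rfl]
  congr 1
  refine Finset.prod_congr rfl fun i hi => ?_
  rw [if_neg (Finset.ne_of_mem_erase hi)]

/-- A parameter point with vanishing nomes whose theta sequence satisfies an order-7 Somos
recurrence. -/
def solitonParams (F : Type*) [Field F] : Fin 11 → F :=
  ![0, 0, -1 / 935, 935, 935, 2, 3, 1, 1, 1, 1]

theorem thetaLowIndices_eq : thetaLowIndices = {(-1, -1), (-1, 0), (-1, 1), (-1, 2),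
    (0, -1), (0, 0), (0, 1), (0, 2), (1, -1), (1, 0), (1, 1), (1, 2), (2, -1), (2, 0), (2, 1),
    (2, 2)} := by
  unfold thetaLowIndices
  decide

/-- The partial derivatives at `solitonParams` of the term of a theta sequence at position `p`. -/
def solitonJacobian (F : Type*) [Field F] (p : ℤ) : Fin 11 → F :=
  ![(935 * 2 ^ p)⁻¹ * (1 - 935 * (935 * 3 ^ p)) + (935 * 2 ^ p) ^ 2 * (1 + 935 * 3 ^ p / 935 ^ 2),
    (935 * 3 ^ p)⁻¹ * (1 - 935 * (935 * 2 ^ p)) + (935 * 3 ^ p) ^ 2 * (1 + 935 * 2 ^ p / 935 ^ 2),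
    935 ^ 2 * 2 ^ p * 3 ^ p, 2 ^ p * (1 - 3 ^ p), 3 ^ p * (1 - 2 ^ p),
    935 * p * 2 ^ p * (1 - 3 ^ p) / 2, 935 * p * 3 ^ p * (1 - 2 ^ p) / 3,
    1 + 935 * 2 ^ p + 935 * 3 ^ p - 935 * 2 ^ p * 3 ^ p,
    (p % 2 : ℤ) * (1 + 935 * 2 ^ p + 935 * 3 ^ p - 935 * 2 ^ p * 3 ^ p),
    p * (1 + 935 * 2 ^ p + 935 * 3 ^ p - 935 * 2 ^ p * 3 ^ p),
    p ^ 2 * (1 + 935 * 2 ^ p + 935 * 3 ^ p - 935 * 2 ^ p * 3 ^ p)]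

set_option maxHeartbeats 2000000 in
-- At zero nomes, a term contributes to a nome derivative only if it has degree one in that nome and
-- zero in the other; the other derivatives see only degree zero.
theorem sum_laurentMonomialPartial_solitonParams {F : Type*} [Field F] [CharZero F] (p : ℤ)
    (j : Fin 11) :
    ∑ μ ∈ thetaLowIndices, laurentMonomialPartial (thetaExponent p μ) (solitonParams F) j =
      solitonJacobian F p j := by
  have h2 : (2 : F) ^ (p - 1) = 2 ^ p / 2 := by rw [zpow_sub_one₀ two_ne_zero, div_eq_mul_inv]
  have h3 : (3 : F) ^ (p - 1) = 3 ^ p / 3 := by rw [zpow_sub_one₀ three_ne_zero, div_eq_mul_inv]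
  have n2 : (2 : F) ^ p ≠ 0 := zpow_ne_zero _ two_ne_zero
  have n3 : (3 : F) ^ p ≠ 0 := zpow_ne_zero _ three_ne_zero
  rw [thetaLowIndices_eq]
  simp_rw [laurentMonomialPartial_eq_prod]
  fin_cases j <;>
  · simp [Fin.prod_univ_succ, solitonParams, thetaExponent, solitonJacobian, zpow_mul, h2, h3]
    try field_simp
    try ring

/-- The Jacobian of the first eleven terms, with rows and denominators cleared. -/
def solitonMatrix (R : Type*) [CommRing R] : Matrix (Fin 11) (Fin 11) R := Matrix.of fun p =>
  ![6 * 3 ^ (p : ℕ) * (1 - 935 ^ 2 * 3 ^ (p : ℕ)) +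
      6 ^ (p + 1 : ℕ) * (2 ^ (p : ℕ)) ^ 2 * (935 ^ 3 + 935 ^ 2 * 3 ^ (p : ℕ)),
    6 * 2 ^ (p : ℕ) * (1 - 935 ^ 2 * 2 ^ (p : ℕ)) +
      6 ^ (p + 1 : ℕ) * (3 ^ (p : ℕ)) ^ 2 * (935 ^ 3 + 935 ^ 2 * 2 ^ (p : ℕ)),
    935 * 6 ^ (p + 1 : ℕ) * (935 ^ 2 * 2 ^ (p : ℕ) * 3 ^ (p : ℕ)),
    935 * 6 ^ (p + 1 : ℕ) * (2 ^ (p : ℕ) * (1 - 3 ^ (p : ℕ))),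
    935 * 6 ^ (p + 1 : ℕ) * (3 ^ (p : ℕ) * (1 - 2 ^ (p : ℕ))),
    935 ^ 2 * 3 * 6 ^ (p : ℕ) * (p : ℕ) * 2 ^ (p : ℕ) * (1 - 3 ^ (p : ℕ)),
    935 ^ 2 * 2 * 6 ^ (p : ℕ) * (p : ℕ) * 3 ^ (p : ℕ) * (1 - 2 ^ (p : ℕ)),
    935 * 6 ^ (p + 1 : ℕ) *
      (1 + 935 * 2 ^ (p : ℕ) + 935 * 3 ^ (p : ℕ) - 935 * 2 ^ (p : ℕ) * 3 ^ (p : ℕ)),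
    935 * 6 ^ (p + 1 : ℕ) * ((p % 2 : ℕ) *
      (1 + 935 * 2 ^ (p : ℕ) + 935 * 3 ^ (p : ℕ) - 935 * 2 ^ (p : ℕ) * 3 ^ (p : ℕ))),
    935 * 6 ^ (p + 1 : ℕ) * ((p : ℕ) *
      (1 + 935 * 2 ^ (p : ℕ) + 935 * 3 ^ (p : ℕ) - 935 * 2 ^ (p : ℕ) * 3 ^ (p : ℕ))),
    935 * 6 ^ (p + 1 : ℕ) * ((p : ℕ) ^ 2 *
      (1 + 935 * 2 ^ (p : ℕ) + 935 * 3 ^ (p : ℕ) - 935 * 2 ^ (p : ℕ) * 3 ^ (p : ℕ)))]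

theorem solitonMatrix_map {R S : Type*} [CommRing R] [CommRing S] (f : R →+* S) :
    (solitonMatrix R).map f = solitonMatrix S := by
  have h2 : f 2 = 2 := map_ofNat f 2
  have h3 : f 3 = 3 := map_ofNat f 3
  have h6 : f 6 = 6 := map_ofNat f 6
  have h935 : f 935 = 935 := map_ofNat f 935
  ext p j
  fin_cases j <;> simp [solitonMatrix, h2, h3, h6, h935]

theorem solitonMatrix_eq {F : Type*} [Field F] [CharZero F] (p j : Fin 11) :
    solitonMatrix F p j = 935 * 6 ^ (p + 1 : ℕ) * solitonJacobian F (p : ℕ) j := by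
  have n2 : (2 : F) ^ (p : ℕ) ≠ 0 := pow_ne_zero _ two_ne_zero
  have n3 : (3 : F) ^ (p : ℕ) ≠ 0 := pow_ne_zero _ three_ne_zero
  have h6 : (6 : F) ^ (p : ℕ) = 2 ^ (p : ℕ) * 3 ^ (p : ℕ) := by rw [← mul_pow]; norm_num
  have hp : ((((p : ℕ) : ℤ) % 2 : ℤ) : F) = ((p % 2 : ℕ) : F) := by exact_mod_cast rfl
  fin_cases j <;> simp only [solitonMatrix, solitonJacobian, Matrix.of_apply] <;>
    simp [pow_succ, h6, hp] <;> try field_simp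
  all_goals try ring

/-- An explicit inverse modulo `q` makes the determinant a unit there, so one matrix product is
checked instead of a determinant being expanded. -/
theorem det_ne_zero_of_modEq_inverse {n : Type*} [Fintype n] [DecidableEq n] {M : Matrix n n ℤ}
    {q : ℕ} (hq : 1 < q) (W : Matrix n n (ZMod q))
    (h : M.map (Int.castRingHom (ZMod q)) * W = 1) : M.det ≠ 0 := by
  have : Fact (1 < q) := ⟨hq⟩
  intro h0
  have h1 := congrArg Matrix.det h
  rw [Matrix.det_mul, ← RingHom.mapMatrix_apply, ← RingHom.map_det, h0, map_zero, zero_mul,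
    Matrix.det_one] at h1
  exact zero_ne_one h1

theorem det_solitonMatrix_ne_zero : (solitonMatrix ℤ).det ≠ 0 := by
  -- The modulus has to avoid the primes of `6` and `935 = 5 * 11 * 17`, which divide whole columns.
  refine det_ne_zero_of_modEq_inverse (q := 19) (by norm_num)
    !![11, 6, 7, 8, 0, 6, 14, 12, 14, 7, 12;
      14, 2, 11, 2, 1, 0, 7, 14, 14, 15, 5;
      12, 13, 1, 10, 6, 11, 17, 6, 0, 8, 17;
      6, 7, 2, 2, 14, 1, 11, 13, 0, 15, 5;
      11, 5, 13, 15, 9, 17, 8, 18, 2, 7, 4;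
      1, 18, 14, 14, 3, 11, 18, 2, 5, 6, 10;
      3, 10, 11, 0, 18, 9, 4, 18, 17, 7, 10;
      17, 16, 1, 2, 7, 8, 17, 16, 4, 15, 11;
      18, 12, 17, 4, 5, 10, 16, 16, 10, 6, 1;
      9, 6, 5, 18, 2, 15, 4, 9, 4, 18, 4;
      15, 12, 17, 15, 0, 14, 14, 10, 16, 14, 3] ?_
  rw [solitonMatrix_map]
  decide +kernel

theorem exists_sum_solitonJacobian_eq {F : Type*} [Field F] [CharZero F] (v : Fin 11 → F) :
    ∃ h : Fin 11 → F, ∀ p : Fin 11, ∑ j, solitonJacobian F (p : ℕ) j * h j = v p := by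
  have hdet : IsUnit (solitonMatrix F).det := by
    rw [← solitonMatrix_map (Int.castRingHom F), ← RingHom.mapMatrix_apply, ← RingHom.map_det,
      isUnit_iff_ne_zero]
    exact Int.cast_ne_zero.mpr det_solitonMatrix_ne_zero
  refine ⟨(solitonMatrix F)⁻¹.mulVec fun p => 935 * 6 ^ (p + 1 : ℕ) * v p, fun p => ?_⟩
  have h1 := congrFun (Matrix.mulVec_mulVec (fun p : Fin 11 => 935 * 6 ^ (p + 1 : ℕ) * v p)
    (solitonMatrix F) (solitonMatrix F)⁻¹) p
  rw [Matrix.mul_nonsing_inv _ hdet, Matrix.one_mulVec, Matrix.mulVec, dotProduct] at h1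
  simp_rw [solitonMatrix_eq, mul_assoc (935 * 6 ^ (p + 1 : ℕ) : F)] at h1
  rw [← Finset.mul_sum] at h1
  refine mul_left_cancel₀ ?_ h1
  exact mul_ne_zero (by norm_num) (pow_ne_zero _ (by norm_num))

/-- A strict derivative onto the target makes the map locally open, so eleven nearby terms can be
prescribed freely. -/
theorem map_nhds_solitonParams {K : Type*} [NontriviallyNormedField K] [IsUltrametricDist K]
    [CompleteSpace K] [CharZero K] (h2 : ∀ i, 2 ≤ i → ‖solitonParams K i‖ = 1) :
    Filter.map (fun t (p : Fin 11) => thetaSeq (p : ℕ) t) (𝓝 (solitonParams K)) =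
      𝓝 (fun p : Fin 11 => thetaSeq (p : ℕ) (solitonParams K)) := by
  have hder := hasStrictFDerivAt_pi.mpr fun p : Fin 11 =>
    hasStrictFDerivAt_thetaSeq (t₀ := solitonParams K) rfl rfl h2 ((p : ℕ) : ℤ)
  refine hder.map_nhds_eq_of_surj (LinearMap.range_eq_top.mpr fun v => ?_)
  obtain ⟨h, hh⟩ := exists_sum_solitonJacobian_eq v
  refine ⟨h, funext fun p => ?_⟩
  rw [← hh p]
  simp_rw [← sum_laurentMonomialPartial_solitonParams, Finset.sum_mul]
  rw [Finset.sum_comm]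
  simp

/-! ### Somos sequences near the soliton are theta sequences. -/

theorem exists_thetaSeq_mul_eq_sum_fin {K : Type*} [NormedField K] [IsUltrametricDist K]
    [CompleteSpace K] {r : ℝ} (hr : 0 ≤ r) (hr1 : r < 1) {t : Fin 11 → K} (ht : ThetaDomain r t)
    (m : ℤ) : ∃ X Y : ℤ → Fin 4 → K, ∀ P c : ℤ, (Odd m ∨ Even m ∧ Even c) →
      thetaSeq (P + c) t * thetaSeq (P + m - c) t = ∑ k, X P k * Y c k := by
  obtain ⟨X, Y, h⟩ := exists_thetaSeq_mul_eq_sum hr hr1 ht m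
  refine ⟨fun P k => X P (finProdFinEquiv.symm k), fun c k => Y c (finProdFinEquiv.symm k),
    fun P c hc => ?_⟩
  rw [h P c hc]
  exact (Equiv.sum_comp finProdFinEquiv.symm fun κ => X P κ * Y c κ).symm

/-- A product through a four-dimensional space is padded by zeros to a product of square matrices,
one of which has a zero column. -/
theorem det_sum_mul_eq_zero {K : Type*} [Field K] (X Y : Fin 5 → Fin 4 → K) :
    (Matrix.of fun i j => ∑ k, X i k * Y j k).det = 0 := by
  have h : (Matrix.of fun i j => ∑ k, X i k * Y j k) =
      (Matrix.of fun i (k : Fin 5) => Fin.cons (0 : K) (X i) k) *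
        (Matrix.of fun (k : Fin 5) j => Fin.cons (0 : K) (Y j) k) := by
    ext i j
    simp [Matrix.mul_apply, Fin.sum_univ_succ]
  rw [h, Matrix.det_mul, Matrix.det_eq_zero_of_column_eq_zero 0 (fun i => by simp), zero_mul]

theorem continuousAt_somosSeven {K : Type*} [NontriviallyNormedField K] {w₀ : Fin 10 → K} {L : ℕ}
    (h : ∀ n < L, somosSeven w₀ n ≠ 0) :
    ∀ n ≤ L, ContinuousAt (fun w => somosSeven w n) w₀ := by
  intro n
  induction n using Nat.strong_induction_on with
  | _ n ih =>
    intro hn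
    rcases lt_or_ge n 7 with h7 | h7
    · simp_rw [somosSeven_of_lt _ h7]
      exact (continuous_apply _).continuousAt
    · obtain ⟨k, rfl⟩ := Nat.exists_eq_add_of_le' h7
      simp_rw [somosSeven_add_seven]
      have e0 := ih k (by omega) (by omega)
      have e1 := ih (k + 1) (by omega) (by omega)
      have e2 := ih (k + 2) (by omega) (by omega)
      have e3 := ih (k + 3) (by omega) (by omega)
      have e4 := ih (k + 4) (by omega) (by omega)
      have e5 := ih (k + 5) (by omega) (by omega)
      have e6 := ih (k + 6) (by omega) (by omega)
      have hk := h k (by omega)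
      have c : ∀ i, ContinuousAt (fun w : Fin 10 → K => w i) w₀ := fun i =>
        (continuous_apply i).continuousAt
      exact ((((((c 7).mul e1).mul e6).add (((c 8).mul e2).mul e5)).add
        (((c 9).mul e3).mul e4)).neg).div e0 hk

/-- The seed and coefficients of the sequence at `solitonParams`. -/
def solitonData (F : Type*) [Field F] : Fin 10 → F :=
  ![936, -934, -21504, -169234, -1121064, -7013434, -42881904, -41 / 6, 91 / 6, -28 / 3]

section soliton
variable {K : Type*} [NontriviallyNormedField K]

theorem thetaSeq_solitonParams [CharZero K] (p : ℤ) : thetaSeq p (solitonParams K) =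
    1 + 935 * 2 ^ p + 935 * 3 ^ p - 935 * 2 ^ p * 3 ^ p := by
  have h : (935 : K) ≠ 0 := by norm_num
  rw [thetaSeq_eq_of_nome_eq_zero rfl rfl]
  simp [solitonParams]
  field_simp
  ring

theorem thetaSeq_solitonParams_ne_zero [CharZero K] {n : ℕ} (hn : n ≤ 10) :
    thetaSeq (n : ℤ) (solitonParams K) ≠ 0 := by
  rw [thetaSeq_solitonParams]
  simp only [zpow_natCast]
  interval_cases n <;> norm_num

/-- The three recurrence coefficients are those for which the terms in `1`, `2 ^ p` and `3 ^ p`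
cancel; cancellation in `6 ^ p` then forces the interaction `-1 / 935`, and amplitudes `935` keep
the sequence integral. -/
theorem somosSeven_solitonData [CharZero K] {n : ℕ} (hn : n ≤ 10) :
    somosSeven (solitonData K) n = thetaSeq (n : ℤ) (solitonParams K) := by
  refine (eq_somosSeven (solitonData K) (L := 10) (s := fun n => thetaSeq (n : ℤ) (solitonParams K))
    (fun n hn => ?_) (fun n hn => thetaSeq_solitonParams_ne_zero hn) (fun n hn => ?_) n hn).symm
  · simp only [thetaSeq_solitonParams, zpow_natCast]
    interval_cases n <;> simp [solitonData] <;> norm_num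
  · simp only [thetaSeq_solitonParams, zpow_natCast]
    have h3 : n ≤ 3 := by omega
    have e7 : solitonData K 7 = -41 / 6 := rfl
    have e8 : solitonData K 8 = 91 / 6 := rfl
    have e9 : solitonData K 9 = -28 / 3 := rfl
    rw [e7, e8, e9]
    interval_cases n <;> norm_num

/-- Four rows already attain rank four. Column `-1` stands in for `0`, because columns `0, 1, 2, 3`
are dependent by the order-7 recurrence. -/
theorem det_thetaSeq_solitonParams_ne_zero [CharZero K] :
    (Matrix.of fun P c : Fin 4 => thetaSeq ((P : ℕ) + ![(-1 : ℤ), 1, 2, 3] c) (solitonParams K) *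
      thetaSeq ((P : ℕ) + 7 - ![(-1 : ℤ), 1, 2, 3] c) (solitonParams K)).det ≠ 0 := by
  simp only [thetaSeq_solitonParams]
  simp [Matrix.det_succ_row_zero, Fin.sum_univ_succ, Fin.succAbove]
  norm_num [zpow_neg, zpow_ofNat]

end soliton

/-- Near `solitonData`, Somos sequences of order 7 are theta sequences. -/
theorem eventually_exists_eq_thetaSeq {K : Type*} [NontriviallyNormedField K] [IsUltrametricDist K]
    [CompleteSpace K] [CharZero K] (h2 : ∀ i, 2 ≤ i → ‖solitonParams K i‖ = 1) :
    ∀ᶠ w in 𝓝 (solitonData K), ∀ M, 10 ≤ M → (∀ n ≤ M, somosSeven w n ≠ 0) →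
      ∃ t, ThetaDomain (1 / 2) t ∧ ∀ n ≤ M, somosSeven w n = thetaSeq (n : ℤ) t := by
  have hcont : ∀ p : ℤ, ContinuousAt (thetaSeq p) (solitonParams K) := fun p =>
    (hasStrictFDerivAt_thetaSeq (t₀ := solitonParams K) rfl rfl h2 p).continuousAt
  have hdet : ∀ᶠ t in 𝓝 (solitonParams K), (Matrix.of fun P c : Fin 4 =>
      thetaSeq ((P : ℕ) + ![(-1 : ℤ), 1, 2, 3] c) t *
      thetaSeq ((P : ℕ) + 7 - ![(-1 : ℤ), 1, 2, 3] c) t).det ≠ 0 := by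
    refine ContinuousAt.eventually_ne ?_ det_thetaSeq_solitonParams_ne_zero
    have hM : ContinuousAt (fun t => (Matrix.of fun P c : Fin 4 =>
        thetaSeq ((P : ℕ) + ![(-1 : ℤ), 1, 2, 3] c) t *
        thetaSeq ((P : ℕ) + 7 - ![(-1 : ℤ), 1, 2, 3] c) t)) (solitonParams K) :=
      continuousAt_pi.mpr fun P => continuousAt_pi.mpr fun c => (hcont _).mul (hcont _)
    exact (Continuous.matrix_det continuous_id).continuousAt.comp hM
  have hgood := (eventually_thetaDomain (t₀ := solitonParams K) rfl rfl h2
    (one_half_pos (α := ℝ))).and hdet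
  have himage := image_mem_map (m := fun t (p : Fin 11) => thetaSeq ((p : ℕ) : ℤ) t) hgood
  rw [map_nhds_solitonParams h2] at himage
  have hs : ContinuousAt (fun w (p : Fin 11) => somosSeven w (p : ℕ)) (solitonData K) :=
    continuousAt_pi.mpr fun p => continuousAt_somosSeven (L := 10) (fun n hn => by
      rw [somosSeven_solitonData hn.le]
      exact thetaSeq_solitonParams_ne_zero hn.le) p (by omega)
  have hbase : (fun p : Fin 11 => somosSeven (solitonData K) (p : ℕ)) =
      fun p : Fin 11 => thetaSeq ((p : ℕ) : ℤ) (solitonParams K) :=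
    funext fun p => somosSeven_solitonData (by omega)
  rw [← hbase] at himage
  filter_upwards [hs himage] with w hw M hM hne
  obtain ⟨t, ⟨ht, hdet⟩, heq⟩ := hw
  have heq : ∀ n : ℕ, n ≤ 10 → thetaSeq (n : ℤ) t = somosSeven w n := fun n hn =>
    congrFun heq ⟨n, by omega⟩
  refine ⟨t, ht, ?_⟩
  obtain ⟨X, Y, hXY⟩ := exists_thetaSeq_mul_eq_sum_fin (by norm_num) (by norm_num) ht 7
  have hXY : ∀ P c : ℤ, thetaSeq (P + c) t * thetaSeq (P + 7 - c) t = ∑ k, X P k * Y c k :=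
    fun P c => hXY P c (Or.inl (by decide))
  have hX : (Matrix.of fun (P : Fin 4) k => X (P : ℕ) k).det ≠ 0 := by
    intro h0
    apply hdet
    have : (Matrix.of fun P c : Fin 4 => thetaSeq ((P : ℕ) + ![(-1 : ℤ), 1, 2, 3] c) t *
        thetaSeq ((P : ℕ) + 7 - ![(-1 : ℤ), 1, 2, 3] c) t) =
        (Matrix.of fun (P : Fin 4) k => X (P : ℕ) k) *
          (Matrix.of fun k (c : Fin 4) => Y (![(-1 : ℤ), 1, 2, 3] c) k) := by
      ext P c
      simp only [Matrix.of_apply, Matrix.mul_apply]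
      exact hXY _ _
    rw [this, Matrix.det_mul, h0, zero_mul]
  -- `Z` is the column combination prescribed by the recurrence. The relation at rows `0` to `3`
  -- uses exactly the eleven matched terms and forces `Z = 0`, which is the recurrence at every row.
  set Z : Fin 4 → K := fun k => Y 0 k + w 7 * Y 1 k + w 8 * Y 2 k + w 9 * Y 3 k with hZ
  have hrel : ∀ P : ℤ, ∑ k, X P k * Z k = thetaSeq P t * thetaSeq (P + 7) t +
      w 7 * thetaSeq (P + 1) t * thetaSeq (P + 6) t +
      w 8 * thetaSeq (P + 2) t * thetaSeq (P + 5) t +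
      w 9 * thetaSeq (P + 3) t * thetaSeq (P + 4) t := by
    intro P
    have e0 := hXY P 0
    have e1 := hXY P 1
    have e2 := hXY P 2
    have e3 := hXY P 3
    rw [add_zero, sub_zero] at e0
    rw [show P + 7 - 1 = P + 6 by ring] at e1
    rw [show P + 7 - 2 = P + 5 by ring] at e2
    rw [show P + 7 - 3 = P + 4 by ring] at e3
    rw [mul_assoc (w 7), mul_assoc (w 8), mul_assoc (w 9), e0, e1, e2, e3, Finset.mul_sum,
      Finset.mul_sum, Finset.mul_sum, ← Finset.sum_add_distrib, ← Finset.sum_add_distrib,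
      ← Finset.sum_add_distrib]
    exact Finset.sum_congr rfl fun k _ => by rw [hZ]; ring
  have hZ0 : Z = 0 := by
    refine Matrix.eq_zero_of_mulVec_eq_zero hX (funext fun P => ?_)
    simp only [Matrix.mulVec, dotProduct, Matrix.of_apply, Pi.zero_apply]
    rw [hrel]
    have hP := P.isLt
    have h := somosSeven_relation w (hne P (by omega))
    rw [← heq P (by omega), ← heq (P + 1) (by omega), ← heq (P + 2) (by omega),
      ← heq (P + 3) (by omega), ← heq (P + 4) (by omega), ← heq (P + 5) (by omega),
      ← heq (P + 6) (by omega), ← heq (P + 7) (by omega)] at h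
    exact_mod_cast h
  have hrec : ∀ P : ℤ, thetaSeq P t * thetaSeq (P + 7) t +
      w 7 * thetaSeq (P + 1) t * thetaSeq (P + 6) t +
      w 8 * thetaSeq (P + 2) t * thetaSeq (P + 5) t +
      w 9 * thetaSeq (P + 3) t * thetaSeq (P + 4) t = 0 := fun P => by
    rw [← hrel, hZ0]; simp
  intro n
  induction n using Nat.strong_induction_on with
  | _ n ih =>
    intro hn
    rcases lt_or_ge n 7 with h7 | h7
    · exact (heq n (by omega)).symm
    · obtain ⟨k, rfl⟩ := Nat.exists_eq_add_of_le' h7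
      have hk := hne k (by omega)
      have h := hrec k
      refine mul_left_cancel₀ hk ?_
      have h' := somosSeven_relation w hk
      rw [ih k (by omega) (by omega), ih (k + 1) (by omega) (by omega),
        ih (k + 2) (by omega) (by omega), ih (k + 3) (by omega) (by omega),
        ih (k + 4) (by omega) (by omega), ih (k + 5) (by omega) (by omega),
        ih (k + 6) (by omega) (by omega)] at h'
      rw [ih k (by omega) (by omega)]
      push_cast at h' ⊢
      linear_combination h' - h

/-! ### The rank bound over every field. -/

/-- This is what the choice of 7 is for: it is the least prime dividing none of `2`, `3` and `935 =
5 * 11 * 17`. -/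
theorem norm_solitonParams_eq_one [Fact (Nat.Prime 7)] (i : Fin 11) (hi : 2 ≤ i) :
    ‖solitonParams ℚ_[7] i‖ = 1 := by
  have h : ∀ n : ℕ, Nat.Coprime 7 n → ‖(n : ℚ_[7])‖ = 1 := fun n hn =>
    Padic.norm_natCast_eq_one_iff.mpr hn
  have h2 : ‖(2 : ℚ_[7])‖ = 1 := by exact_mod_cast h 2 (by norm_num)
  have h3 : ‖(3 : ℚ_[7])‖ = 1 := by exact_mod_cast h 3 (by norm_num)
  have h935 : ‖(935 : ℚ_[7])‖ = 1 := by exact_mod_cast h 935 (by norm_num)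
  fin_cases i <;> simp_all [solitonParams]

/-- For a Somos sequence of order 7 with nonzero terms and a fixed sum of positions, the products of
two terms form a matrix of rank at most four. -/
theorem det_somosSeven_eq_zero {F : Type} [Field F] (w : Fin 10 → F) {L : ℕ}
    (hw : ∀ n ≤ L, somosSeven w n ≠ 0) (m : ℕ) (P c : Fin 5 → ℕ) (hP : ∀ i, P i + m ≤ L)
    (hc : ∀ j, c j ≤ m) (hpar : Odd m ∨ Even m ∧ ∀ j, Even (c j)) :
    (Matrix.of fun i j => somosSeven w (P i + c j) * somosSeven w (P i + (m - c j))).det = 0 := by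
  have : Fact (Nat.Prime 7) := ⟨by norm_num⟩
  -- The bound is raised to at least 10 because the comparison with theta sequences needs eleven
  -- terms even when `L` is smaller.
  refine det_somosSeven_eq_zero_of_eventually (K := ℚ_[7]) (w₀ := solitonData ℚ_[7])
    (fun i j => P i + c j) (fun i j => P i + (m - c j)) L (max L 10) ?_ (le_max_left _ _)
    (fun i j => ?_) (fun i j => ?_) w hw
  · filter_upwards [eventually_exists_eq_thetaSeq norm_solitonParams_eq_one] with v hv hne
    obtain ⟨t, ht, heq⟩ := hv _ (le_max_right _ _) hne
    obtain ⟨X, Y, hXY⟩ := exists_thetaSeq_mul_eq_sum_fin (by norm_num) (by norm_num) ht m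
    refine Eq.trans (congrArg Matrix.det ?_)
      (det_sum_mul_eq_zero (fun i => X (P i)) fun j => Y (c j))
    ext i j
    have h1 := hP i
    have h2 := hc j
    have h3 := le_max_left L 10
    simp only [Matrix.of_apply]
    rw [heq _ (by omega), heq _ (by omega), ← hXY]
    · push_cast [Nat.cast_sub h2]
      rw [add_sub_assoc]
    · rcases hpar with h | ⟨h, h'⟩
      · exact Or.inl (by exact_mod_cast h)
      · exact Or.inr ⟨by exact_mod_cast h, by exact_mod_cast h' j⟩
  · have := hP i; have := hc j; omega
  · have := hP i; have := hc j; omega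

/-! ### The unit sequence and the sharpness of the orders. -/

/-- The unit Somos sequence of order 7. -/
noncomputable def unitSomos (i : ℤ) : ℂ :=
  ((somosSeven (unitSomosData ℚ) (if 0 ≤ i then i else 6 - i).toNat : ℚ) : ℂ)

theorem unitSomos_natCast (n : ℕ) :
    unitSomos n = ((somosSeven (unitSomosData ℚ) n : ℚ) : ℂ) := by
  simp [unitSomos]

theorem unitSomos_ne_zero (i : ℤ) : unitSomos i ≠ 0 :=
  Rat.cast_ne_zero.mpr (somosSeven_unit_pos _).ne'

theorem unitSomos_of_lt {n : ℕ} (h : n < 7) : unitSomos n = 1 := by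
  rw [unitSomos_natCast, somosSeven_of_lt _ h, unitSomosData,
    if_pos (by simpa [Fin.lt_def] using h), Rat.cast_one]

theorem unitSomos_reflect (i : ℤ) : unitSomos (6 - i) = unitSomos i := by
  have key : ∀ j : ℤ, j < 0 → unitSomos (6 - j) = unitSomos j := fun j hj => by
    simp only [unitSomos]
    rw [if_pos (by omega), if_neg (by omega)]
  rcases lt_or_ge i 0 with h | h
  · exact key i h
  · rcases lt_or_ge 6 i with h6 | h6
    · rw [← key (6 - i) (by omega), sub_sub_cancel]
    · lift i to ℕ using h
      obtain ⟨k, hk⟩ : ∃ k : ℕ, (6 - i : ℤ) = k := ⟨6 - i, by omega⟩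
      rw [hk, unitSomos_of_lt (by omega), unitSomos_of_lt (by omega)]

theorem unitSomos_mul_add_seven (i : ℤ) : unitSomos i * unitSomos (i + 7) =
    unitSomos (i + 1) * unitSomos (i + 6) + unitSomos (i + 2) * unitSomos (i + 5) +
      unitSomos (i + 3) * unitSomos (i + 4) := by
  have key : ∀ n : ℕ, unitSomos n * unitSomos (n + 7) =
      unitSomos (n + 1) * unitSomos (n + 6) + unitSomos (n + 2) * unitSomos (n + 5) +
        unitSomos (n + 3) * unitSomos (n + 4) := fun n => by
    have h := somosSeven_relation (unitSomosData ℚ) (somosSeven_unit_pos n).ne'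
    have h7 : unitSomosData ℚ 7 = -1 := if_neg (by decide)
    have h8 : unitSomosData ℚ 8 = -1 := if_neg (by decide)
    have h9 : unitSomosData ℚ 9 = -1 := if_neg (by decide)
    rw [h7, h8, h9] at h
    have h' := congrArg (Rat.cast : ℚ → ℂ) h
    push_cast [← unitSomos_natCast] at h'
    linear_combination h'
  rcases lt_or_ge i 0 with h | h
  · obtain ⟨n, hn⟩ : ∃ n : ℕ, -1 - i = n := ⟨(-1 - i).toNat, by omega⟩
    have e := key n
    rw [← hn, show -1 - i + 7 = 6 - i by ring, show -1 - i + 1 = 6 - (i + 6) by ring,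
      show -1 - i + 6 = 6 - (i + 1) by ring, show -1 - i + 2 = 6 - (i + 5) by ring,
      show -1 - i + 5 = 6 - (i + 2) by ring, show -1 - i + 3 = 6 - (i + 4) by ring,
      show -1 - i + 4 = 6 - (i + 3) by ring, show -1 - i = 6 - (i + 7) by ring] at e
    simp only [unitSomos_reflect] at e
    linear_combination e
  · lift i to ℕ using h
    exact key i

theorem isUnitSomos_unitSomos : IsUnitSomos 7 unitSomos := by
  refine ⟨fun i h0 h7 => ?_, fun i => ?_⟩
  · lift i to ℕ using h0
    exact unitSomos_of_lt (by exact_mod_cast h7)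
  · have h : Finset.Icc 1 (7 / 2) = {1, 2, 3} := by decide
    rw [h]
    simp only [Finset.mem_insert, Finset.mem_singleton, OfNat.one_ne_ofNat, or_self,
      not_false_eq_true, Finset.sum_insert, Nat.reduceEqDiff, Finset.sum_singleton]
    have e := unitSomos_mul_add_seven i
    push_cast
    rw [show i + 7 - 1 = i + 6 by ring, show i + 7 - 2 = i + 5 by ring,
      show i + 7 - 3 = i + 4 by ring, e, add_assoc]

theorem isSomos_unitSomos : IsSomos 7 Set.univ unitSomos := by
  refine ⟨![1, -1, -1, -1], by simp, fun i _ => ?_⟩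
  have e := unitSomos_mul_add_seven i
  simp only [Nat.reduceDiv, Nat.reduceAdd, Fin.sum_univ_succ, Fin.sum_univ_zero]
  simp
  rw [show i + 7 - 1 = i + 6 by ring, show i + 7 - 2 = i + 5 by ring,
    show i + 7 - 3 = i + 4 by ring]
  linear_combination e

/-- The first terms of the unit Somos sequence of order 7. -/
def unitSomosTerms : List ℤ := [
  1,
  1,
  1,
  1,
  1,
  1,
  1,
  3,
  5,
  9,
  17,
  41,
  137,
  769,
  1925,
  7203,
  34081,
  227321,
  1737001,
  14736001,
  63232441,
  702617001,
  8873580481,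
  122337693603,
  1705473647525,
  22511386506929,
  251582370867257,
  9254211194697641,
  215321535159114017,
  5385449696078925209,
  133729227264371122085,
  3727964659731188256003,
  148149559542594032226721,
  11502834647406752329538961,
  407727657085523617507589041,
  19906779388526231667047731201]

/-- The unit Somos sequence of order 7 in the range covered by `unitSomosTerms`. -/
def unitSomosTerm (i : ℤ) : ℤ := unitSomosTerms.getD (if 0 ≤ i then i else 6 - i).toNat 0

theorem somosSeven_unit_eq {n : ℕ} (hn : n ≤ 35) :
    somosSeven (unitSomosData ℚ) n = unitSomosTerms.getD n 0 := by
  have h7 : unitSomosData ℚ 7 = -1 := if_neg (by decide)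
  have h8 : unitSomosData ℚ 8 = -1 := if_neg (by decide)
  have h9 : unitSomosData ℚ 9 = -1 := if_neg (by decide)
  refine (eq_somosSeven (unitSomosData ℚ) (L := 35)
    (s := fun n => ((unitSomosTerms.getD n 0 : ℤ) : ℚ)) (fun n hn => ?_) (fun n hn => ?_)
    (fun n hn => ?_) n hn).symm
  · rw [unitSomosData, if_pos (by simpa [Fin.lt_def] using hn)]
    have : ∀ n < 7, unitSomosTerms.getD n 0 = 1 := by decide
    exact_mod_cast this n hn
  · have : ∀ n < 36, unitSomosTerms.getD n 0 ≠ 0 := by decide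
    exact Int.cast_ne_zero.mpr (this n (by omega))
  · rw [h7, h8, h9]
    have : ∀ n < 29, unitSomosTerms.getD n 0 * unitSomosTerms.getD (n + 7) 0 +
        -1 * unitSomosTerms.getD (n + 1) 0 * unitSomosTerms.getD (n + 6) 0 +
        -1 * unitSomosTerms.getD (n + 2) 0 * unitSomosTerms.getD (n + 5) 0 +
        -1 * unitSomosTerms.getD (n + 3) 0 * unitSomosTerms.getD (n + 4) 0 = 0 := by
      decide +kernel
    exact_mod_cast this n (by omega)

/-- The lower limit is the mirror image `6 - 35` of the upper one. -/
theorem unitSomos_eq_term {i : ℤ} (h1 : -29 ≤ i) (h2 : i ≤ 35) :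
    unitSomos i = (unitSomosTerm i : ℂ) := by
  rw [unitSomos, somosSeven_unit_eq (by split_ifs <;> omega), unitSomosTerm, Rat.cast_intCast]

/-- The coefficient matrix of the linear system that a tuple of coefficients of nonstrict order `n`
for a decimation of the unit Somos sequence satisfies. -/
def unitSomosMatrix (d n : ℕ) (r st : ℤ) : Matrix (Fin (n / 2 + 1)) (Fin (n / 2 + 1)) ℤ :=
  Matrix.of fun i j => unitSomosTerm (r + d * (st + (i : ℕ) + (j : ℕ))) *
    unitSomosTerm (r + d * (st + (i : ℕ) + n - (j : ℕ)))

/-- The `n / 2 + 1` consecutive relations starting at `st` form a square system for the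
coefficients; its invertibility modulo `q` leaves only the zero tuple. -/
theorem not_isNonstrictSomos_unitSomos_decimation (d n : ℕ) (r st : ℤ) (q : ℕ) (hq : 1 < q)
    (W : Matrix (Fin (n / 2 + 1)) (Fin (n / 2 + 1)) (ZMod q))
    (hrange : -29 ≤ r + d * st ∧ r + d * (st + (n / 2 : ℕ) + n) ≤ 35)
    (hW : (unitSomosMatrix d n r st).map (Int.castRingHom (ZMod q)) * W = 1) :
    ¬ IsNonstrictSomos n (decimationIndex d r Set.univ) (decimation d r unitSomos) := by
  rintro ⟨a, ha, h⟩
  have hdet : ((unitSomosMatrix d n r st).map (Int.castRingHom ℂ)).det ≠ 0 := by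
    rw [← RingHom.mapMatrix_apply, ← RingHom.map_det]
    exact Int.cast_ne_zero.mpr (det_ne_zero_of_modEq_inverse hq W hW)
  refine ha (Matrix.eq_zero_of_mulVec_eq_zero hdet (funext fun i => ?_))
  refine Eq.trans ?_ (h (st + (i : ℕ)) fun k _ => Set.mem_univ (r + d * k))
  rw [Matrix.mulVec, dotProduct]
  refine Finset.sum_congr rfl fun j _ => ?_
  have hi := i.isLt
  have hj := j.isLt
  have hd : (0 : ℤ) ≤ d := by positivity
  have lower : ∀ x : ℤ, 0 ≤ x → -29 ≤ r + d * (st + x) := fun x hx => by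
    nlinarith [mul_nonneg hd hx]
  have upper : ∀ x : ℤ, x ≤ (n / 2 : ℕ) + n → r + d * (st + x) ≤ 35 := fun x hx => by
    nlinarith [mul_nonneg hd (sub_nonneg.mpr hx)]
  have bounds : ∀ x : ℤ, 0 ≤ x → x ≤ (n / 2 : ℕ) + n →
      unitSomos (r + d * (st + x)) = (unitSomosTerm (r + d * (st + x)) : ℂ) := fun x h0 h1 =>
    unitSomos_eq_term (lower x h0) (upper x h1)
  have e1 := bounds ((i : ℕ) + (j : ℕ)) (by omega) (by omega)
  have e2 := bounds ((i : ℕ) + n - (j : ℕ)) (by omega) (by omega)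
  rw [← add_assoc] at e1
  rw [← add_sub_assoc, ← add_assoc] at e2
  simp only [unitSomosMatrix, Matrix.map_apply, Matrix.of_apply, decimation, Int.coe_castRingHom,
    Int.cast_mul]
  rw [e1, e2]
  ring

/-- Each case supplies an offset, a first row, a modulus and the inverse matrix, with all positions
inside the tabulated range. -/
theorem exists_not_isNonstrictSomos_unitSomos :
    (∀ n : ℕ, n < 8 → ∃ r : ℤ,
      ¬ IsNonstrictSomos n (decimationIndex 2 r Set.univ) (decimation 2 r unitSomos)) ∧
    (∀ n : ℕ, (Odd n ∧ n < 9) ∨ (Even n ∧ n < 16) → ∃ r : ℤ,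
      ¬ IsNonstrictSomos n (decimationIndex 3 r Set.univ) (decimation 3 r unitSomos)) := by
  constructor
  · intro n hn
    interval_cases n
    · exact ⟨0, not_isNonstrictSomos_unitSomos_decimation 2 0 0 (0) 5 (by decide)
      !![1] (by decide) (by decide +kernel)⟩
    · exact ⟨0, not_isNonstrictSomos_unitSomos_decimation 2 1 0 (0) 5 (by decide)
      !![1] (by decide) (by decide +kernel)⟩
    · exact ⟨1, not_isNonstrictSomos_unitSomos_decimation 2 2 1 (-1) 5 (by decide)
      !![3, 2; 2, 4] (by decide) (by decide +kernel)⟩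
    · exact ⟨0, not_isNonstrictSomos_unitSomos_decimation 2 3 0 (-1) 5 (by decide)
      !![4, 1; 1, 0] (by decide) (by decide +kernel)⟩
    · exact ⟨1, not_isNonstrictSomos_unitSomos_decimation 2 4 1 (-3) 7 (by decide)
      !![4, 0, 6; 0, 4, 3; 6, 3, 0] (by decide) (by decide +kernel)⟩
    · exact ⟨0, not_isNonstrictSomos_unitSomos_decimation 2 5 0 (-3) 5 (by decide)
      !![1, 2, 3; 2, 3, 2; 3, 2, 4] (by decide) (by decide +kernel)⟩
    · exact ⟨1, not_isNonstrictSomos_unitSomos_decimation 2 6 1 (-5) 7 (by decide)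
      !![5, 5, 0, 5; 5, 2, 0, 4; 0, 0, 4, 3; 5, 4, 3, 5] (by decide) (by decide +kernel)⟩
    · exact ⟨0, not_isNonstrictSomos_unitSomos_decimation 2 7 0 (-5) 7 (by decide)
      !![4, 6, 0, 1; 4, 0, 4, 6; 4, 1, 3, 2; 0, 1, 2, 1] (by decide) (by decide +kernel)⟩
  · intro n hn
    have hn' : n < 9 ∨ n = 10 ∨ n = 12 ∨ n = 14 := by
      rcases hn with ⟨-, h⟩ | ⟨⟨k, hk⟩, h⟩ <;> omega
    clear hn
    rcases hn' with hn | rfl | rfl | rfl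
    on_goal 1 => interval_cases n
    · exact ⟨0, not_isNonstrictSomos_unitSomos_decimation 3 0 0 (0) 5 (by decide)
      !![1] (by decide) (by decide +kernel)⟩
    · exact ⟨0, not_isNonstrictSomos_unitSomos_decimation 3 1 0 (0) 5 (by decide)
      !![1] (by decide) (by decide +kernel)⟩
    · exact ⟨1, not_isNonstrictSomos_unitSomos_decimation 3 2 1 (-1) 5 (by decide)
      !![3, 2; 1, 0] (by decide) (by decide +kernel)⟩
    · exact ⟨1, not_isNonstrictSomos_unitSomos_decimation 3 3 1 (-1) 5 (by decide)
      !![1, 3; 1, 0] (by decide) (by decide +kernel)⟩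
    · exact ⟨1, not_isNonstrictSomos_unitSomos_decimation 3 4 1 (-2) 5 (by decide)
      !![0, 4, 4; 3, 1, 4; 1, 3, 3] (by decide) (by decide +kernel)⟩
    · exact ⟨1, not_isNonstrictSomos_unitSomos_decimation 3 5 1 (-3) 5 (by decide)
      !![2, 3, 4; 1, 0, 0; 1, 0, 2] (by decide) (by decide +kernel)⟩
    · exact ⟨1, not_isNonstrictSomos_unitSomos_decimation 3 6 1 (-4) 5 (by decide)
      !![4, 3, 1, 4; 1, 2, 3, 0; 4, 1, 2, 3; 2, 0, 1, 0] (by decide) (by decide +kernel)⟩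
    · exact ⟨1, not_isNonstrictSomos_unitSomos_decimation 3 7 1 (-4) 7 (by decide)
      !![4, 3, 0, 6; 5, 3, 2, 4; 2, 0, 5, 5; 6, 3, 1, 0] (by decide) (by decide +kernel)⟩
    · exact ⟨1, not_isNonstrictSomos_unitSomos_decimation 3 8 1 (-5) 7 (by decide)
      !![3, 0, 5, 6, 3;
        4, 1, 4, 6, 1;
        3, 3, 2, 5, 4;
        2, 0, 6, 1, 6;
        1, 3, 5, 0, 5] (by decide) (by decide +kernel)⟩
    · exact ⟨1, not_isNonstrictSomos_unitSomos_decimation 3 10 1 (-7) 5 (by decide)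
      !![0, 3, 1, 1, 0, 2;
        1, 3, 0, 0, 1, 0;
        1, 1, 1, 4, 0, 1;
        0, 0, 0, 1, 0, 1;
        0, 1, 0, 1, 3, 3;
        1, 0, 0, 1, 1, 0] (by decide) (by decide +kernel)⟩
    · exact ⟨1, not_isNonstrictSomos_unitSomos_decimation 3 12 1 (-8) 7 (by decide)
      !![6, 2, 5, 0, 5, 6, 1;
        2, 6, 6, 2, 4, 0, 0;
        4, 3, 4, 1, 0, 4, 6;
        3, 2, 5, 2, 5, 6, 2;
        3, 2, 3, 3, 4, 6, 5;
        6, 4, 5, 6, 6, 5, 1;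
        1, 4, 6, 6, 2, 5, 0] (by decide) (by decide +kernel)⟩
    · exact ⟨1, not_isNonstrictSomos_unitSomos_decimation 3 14 1 (-10) 7 (by decide)
      !![3, 3, 3, 0, 4, 5, 0, 6;
        5, 4, 0, 5, 2, 4, 6, 4;
        5, 0, 4, 6, 4, 3, 0, 3;
        0, 4, 3, 4, 1, 0, 4, 6;
        3, 6, 5, 5, 6, 3, 6, 1;
        4, 0, 6, 3, 6, 6, 6, 6;
        4, 3, 1, 5, 2, 1, 5, 2;
        4, 5, 1, 6, 2, 4, 5, 1] (by decide) (by decide +kernel)⟩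

/-! ### Coefficients for the decimations. -/

/-- A family of vectors all of whose maximal minors vanish is orthogonal to a nonzero vector. -/
theorem exists_ne_zero_forall_sum_eq_zero {K ι : Type*} [Field K] {k : ℕ} (v : ι → Fin k → K)
    (S : Set ι) (h : ∀ P : Fin k → ι, (∀ i, P i ∈ S) → (Matrix.of fun i => v (P i)).det = 0) :
    ∃ a : Fin k → K, a ≠ 0 ∧ ∀ x ∈ S, ∑ j, a j * v x j = 0 := by
  have hspan : Submodule.span K (v '' S) < ⊤ := by
    rw [lt_top_iff_ne_top]
    intro htop
    obtain ⟨f, hf, -, hli⟩ := Submodule.exists_fun_fin_finrank_span_eq K (v '' S)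
    have hk : Module.finrank K (Submodule.span K (v '' S)) = k := by
      rw [htop, finrank_top, Module.finrank_fin_fun]
    choose P hPS hP using fun i => hf (Fin.cast hk.symm i)
    have hli' : LinearIndependent K (Matrix.of fun i => v (P i)).row := by
      have h1 := hli.comp (Fin.cast hk.symm) (Fin.cast_injective _)
      rw [show f ∘ Fin.cast hk.symm = fun i => v (P i) from (funext hP).symm] at h1
      exact h1
    have h2 := (Matrix.isUnit_iff_isUnit_det _).mp (Matrix.linearIndependent_rows_iff_isUnit.mp hli')
    rw [h P hPS] at h2
    exact not_isUnit_zero h2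
  obtain ⟨f, hf, hle⟩ := Submodule.exists_le_ker_of_lt_top _ hspan
  have hsum : ∀ x : Fin k → K, f x = ∑ j, f (Pi.single j 1) * x j := fun x => by
    conv_lhs => rw [← Finset.univ_sum_single x, map_sum]
    refine Finset.sum_congr rfl fun j _ => ?_
    rw [mul_comm, ← smul_eq_mul, ← map_smul, ← Pi.single_smul, smul_eq_mul, mul_one]
  refine ⟨fun j => f (Pi.single j 1), fun h0 => hf (LinearMap.ext fun x => ?_), fun x hx => ?_⟩
  · rw [hsum]
    simp [fun j => congrFun h0 j]
  · rw [← hsum]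
    exact hle (Submodule.subset_span ⟨x, hx, rfl⟩)

/-- Any five rows lie in a finite window of `I`, where the sequence is generated by its own seed, so
the rank bound kills every maximal minor; a single tuple then annihilates all rows, even for
infinite `I`. -/
theorem exists_coeff_of_isSomos_seven {I : Set ℤ} {s : ℤ → ℂ} (hI : I.OrdConnected)
    (hs : IsSomos 7 I s) (h0 : NonzeroTerms I s) (m : ℕ) (c : Fin 5 → ℕ) (hc : ∀ j, c j ≤ m)
    (hpar : Odd m ∨ Even m ∧ ∀ j, Even (c j)) :
    ∃ a : Fin 5 → ℂ, a ≠ 0 ∧ ∀ P : ℤ, P ∈ I → P + m ∈ I →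
      ∑ j, a j * (s (P + c j) * s (P + (m - c j : ℕ))) = 0 := by
  obtain ⟨b, hb0, hb⟩ := hs
  suffices hdet : ∀ P : Fin 5 → ℤ, (∀ i, P i ∈ {P : ℤ | P ∈ I ∧ P + m ∈ I}) →
      (Matrix.of fun i j => s (P i + c j) * s (P i + (m - c j : ℕ))).det = 0 by
    obtain ⟨a, ha, h⟩ := exists_ne_zero_forall_sum_eq_zero
      (fun (P : ℤ) j => s (P + c j) * s (P + (m - c j : ℕ))) _ hdet
    exact ⟨a, ha, fun P h1 h2 => h P ⟨h1, h2⟩⟩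
  intro P hP
  obtain ⟨lo, -, hlo⟩ := Finset.exists_min_image Finset.univ P Finset.univ_nonempty
  obtain ⟨hi, -, hhi⟩ := Finset.exists_max_image Finset.univ P Finset.univ_nonempty
  have hlo' : ∀ i, P lo ≤ P i := fun i => hlo i (Finset.mem_univ i)
  have hhi' : ∀ i, P i ≤ P hi := fun i => hhi i (Finset.mem_univ i)
  obtain ⟨L, hL⟩ : ∃ L : ℕ, P hi + m - P lo = L := ⟨(P hi + m - P lo).toNat, by
    have := hlo' hi; omega⟩
  have hmem : ∀ x, P lo ≤ x → x ≤ P hi + m → x ∈ I := fun x h1 h2 =>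
    hI.out (hP lo).1 (hP hi).2 ⟨h1, h2⟩
  -- The shift by 6 puts the normalised coefficients `b 1`, `b 2`, `b 3` into slots 7, 8, 9.
  set w : Fin 10 → ℂ := fun i =>
    if h : (i : ℕ) < 7 then s (P lo + (i : ℕ)) else b ⟨i - 6, by omega⟩ / b 0 with hw
  have hne : ∀ n ≤ L, s (P lo + (n : ℕ)) ≠ 0 := fun n hn => h0 _ (hmem _ (by omega) (by omega))
  have hseq : ∀ n ≤ L, s (P lo + (n : ℕ)) = somosSeven w n := by
    refine eq_somosSeven w (s := fun n => s (P lo + (n : ℕ))) (fun n hn => ?_) hne fun n hn => ?_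
    · simp only [hw, dif_pos hn]
    · have h1 := hb (P lo + n) fun x hx => hmem x (by have := hx.1; omega)
        (by have := hx.2; push_cast at this; omega)
      have e7 : w 7 = b 1 / b 0 := rfl
      have e8 : w 8 = b 2 / b 0 := rfl
      have e9 : w 9 = b 3 / b 0 := rfl
      have h2 : b 0 * s (P lo + n) * s (P lo + n + 7) + b 1 * s (P lo + n + 1) * s (P lo + n + 6) +
          b 2 * s (P lo + n + 2) * s (P lo + n + 5) +
          b 3 * s (P lo + n + 3) * s (P lo + n + 4) = 0 := by
        rw [show P lo + n + 6 = P lo + n + 7 - 1 by ring,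
          show P lo + n + 5 = P lo + n + 7 - 2 by ring,
          show P lo + n + 4 = P lo + n + 7 - 3 by ring]
        refine Eq.trans ?_ h1
        exact (by
          change _ = ∑ j : Fin 4, b j * s (P lo + n + ((j : ℕ) : ℤ)) *
            s (P lo + n + ((7 : ℕ) : ℤ) - ((j : ℕ) : ℤ))
          rw [Fin.sum_univ_four]
          simp)
      rw [e7, e8, e9]
      push_cast
      simp only [← add_assoc]
      field_simp
      linear_combination h2
  have hnat : ∀ i, ∃ p : ℕ, P i = P lo + p ∧ p + m ≤ L := fun i =>
    ⟨(P i - P lo).toNat, by have := hlo' i; omega, by have := hlo' i; have := hhi' i; omega⟩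
  choose p hp hpL using hnat
  refine Eq.trans (congrArg Matrix.det ?_)
    (det_somosSeven_eq_zero w (fun n hn => (hseq n hn) ▸ hne n hn) m p c hpL hc hpar)
  ext i j
  have h1 := hpL i
  have h2 := hc j
  simp only [Matrix.of_apply]
  rw [hp i, add_assoc, add_assoc, ← hseq _ (by omega), ← hseq _ (by omega)]
  push_cast
  rfl

/-- Both orders have exactly five coefficients, one for each of the columns `d * j`. -/
theorem exists_coeff_decimation {I : Set ℤ} {s : ℤ → ℂ} (hI : I.OrdConnected)
    (hs : IsSomos 7 I s) (h0 : NonzeroTerms I s) {d : ℕ} {n : ℕ} (hn : n = 8 ∨ n = 9)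
    (h : n = 9 ∨ Even d) :
    ∃ a : Fin (n / 2 + 1) → ℂ, a ≠ 0 ∧
      ∀ r : ℤ, InSomosClass n a (decimationIndex d r I) (decimation d r s) := by
  have hpar : Odd (d * n) ∨ Even (d * n) ∧ ∀ j : Fin 5, Even (d * (j : ℕ)) := by
    rcases Nat.even_or_odd d with hd | hd
    · exact Or.inr ⟨hd.mul_right _, fun j => hd.mul_right _⟩
    · rcases h with rfl | h
      · exact Or.inl (hd.mul (by decide))
      · exact absurd h (Nat.not_even_iff_odd.mpr hd)
  obtain ⟨a, ha, hrel⟩ := exists_coeff_of_isSomos_seven hI hs h0 (d * n) (fun j => d * (j : ℕ))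
    (fun j => Nat.mul_le_mul_left d (by omega)) hpar
  have key : ∀ r i : ℤ, Set.Icc i (i + (n : ℤ)) ⊆ decimationIndex d r I →
      ∑ j : Fin 5, a j * decimation d r s (i + ((j : ℕ) : ℤ)) *
        decimation d r s (i + (n : ℤ) - ((j : ℕ) : ℤ)) = 0 := fun r i hi => by
    have h1 : r + (d : ℤ) * i ∈ I := hi ⟨le_rfl, by omega⟩
    have h2 : r + (d : ℤ) * (i + n) ∈ I := hi ⟨by omega, le_rfl⟩
    refine Eq.trans (Finset.sum_congr rfl fun j _ => ?_)
      (hrel (r + d * i) h1 (by push_cast; rwa [add_assoc, ← mul_add]))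
    rw [← Nat.mul_sub, decimation, decimation, mul_assoc]
    push_cast [Nat.cast_sub (show (j : ℕ) ≤ n by omega)]
    congr 3 <;> ring_nf
  rcases hn with rfl | rfl
  · exact ⟨a, ha, fun r i hi => key r i hi⟩
  · exact ⟨a, ha, fun r i hi => key r i hi⟩

/-- Only the five even-numbered coefficients are used, so all columns are even for every `d`. -/
theorem exists_coeff_decimation_sixteen {I : Set ℤ} {s : ℤ → ℂ} (hI : I.OrdConnected)
    (hs : IsSomos 7 I s) (h0 : NonzeroTerms I s) (d : ℕ) :
    ∃ a : Fin (16 / 2 + 1) → ℂ, a ≠ 0 ∧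
      ∀ r : ℤ, InSomosClass 16 a (decimationIndex d r I) (decimation d r s) := by
  obtain ⟨a, ha, hrel⟩ := exists_coeff_of_isSomos_seven hI hs h0 (d * 16)
    (fun j => d * (2 * (j : ℕ))) (fun j => Nat.mul_le_mul_left d (by omega))
    (Or.inr ⟨(show Even 16 by decide).mul_left _, fun j => (even_two_mul _).mul_left _⟩)
  refine ⟨![a 0, 0, a 1, 0, a 2, 0, a 3, 0, a 4], fun h => ha (funext fun j => ?_),
    fun r i hi => ?_⟩
  · fin_cases j
    · exact congrFun h 0
    · exact congrFun h 2
    · exact congrFun h 4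
    · exact congrFun h 6
    · exact congrFun h 8
  · have h1 : r + (d : ℤ) * i ∈ I := hi ⟨le_rfl, by omega⟩
    have h2 : r + (d : ℤ) * (i + (16 : ℕ)) ∈ I := hi ⟨by omega, le_rfl⟩
    have h3 := hrel (r + d * i) h1 (by push_cast at h2 ⊢; rwa [add_assoc, ← mul_add])
    have h4 : ∀ j : Fin 5, a j * (s (r + d * i + (d * (2 * (j : ℕ)) : ℕ)) *
        s (r + d * i + (d * 16 - d * (2 * (j : ℕ)) : ℕ))) =
        a j * decimation d r s (i + ((2 * (j : ℕ) : ℕ) : ℤ)) *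
          decimation d r s (i + ((16 : ℕ) : ℤ) - ((2 * (j : ℕ) : ℕ) : ℤ)) := fun j => by
      rw [← Nat.mul_sub, decimation, decimation, mul_assoc]
      push_cast [Nat.cast_sub (show 2 * (j : ℕ) ≤ 16 by omega)]
      congr 3 <;> ring_nf
    simp_rw [h4] at h3
    refine Eq.trans ?_ h3
    simp [Fin.sum_univ_succ]

theorem proposition5 :
    -- decimations of an arbitrary order-7 Somos sequence with nonzero terms
    (∀ (I : Set ℤ) (s : ℤ → ℂ), I.OrdConnected → IsSomos 7 I s → NonzeroTerms I s →
      (∀ d : ℕ, 0 < d → Even d → ∀ r : ℤ,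
        IsNonstrictSomos 8 (decimationIndex d r I) (decimation d r s) ∧
        IsNonstrictSomos 9 (decimationIndex d r I) (decimation d r s)) ∧
      (∀ d : ℕ, 0 < d → Odd d → ∀ r : ℤ,
        IsNonstrictSomos 9 (decimationIndex d r I) (decimation d r s) ∧
        IsNonstrictSomos 16 (decimationIndex d r I) (decimation d r s)) ∧
      (∀ d : ℕ, 0 < d → ∀ n ∈ associatedOrders d,
        ∃ a : Fin (n / 2 + 1) → ℂ, a ≠ 0 ∧
          ∀ r : ℤ, InSomosClass n a (decimationIndex d r I) (decimation d r s))) ∧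
    -- the orders are best possible, as the unit Somos sequence of order 7 shows
    (∃ u : ℤ → ℂ, IsUnitSomos 7 u ∧ IsSomos 7 Set.univ u ∧ NonzeroTerms Set.univ u ∧
      (∀ n : ℕ, n < 8 → ∃ r : ℤ,
        ¬ IsNonstrictSomos n (decimationIndex 2 r Set.univ) (decimation 2 r u)) ∧
      (∀ n : ℕ, (Odd n ∧ n < 9) ∨ (Even n ∧ n < 16) → ∃ r : ℤ,
        ¬ IsNonstrictSomos n (decimationIndex 3 r Set.univ) (decimation 3 r u))) := by
  refine ⟨fun I s hI hs h0 => ?_, unitSomos, isUnitSomos_unitSomos, isSomos_unitSomos,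
    fun i _ => unitSomos_ne_zero i, exists_not_isNonstrictSomos_unitSomos⟩
  have common : ∀ d : ℕ, 0 < d → ∀ n ∈ associatedOrders d, ∃ a : Fin (n / 2 + 1) → ℂ, a ≠ 0 ∧
      ∀ r : ℤ, InSomosClass n a (decimationIndex d r I) (decimation d r s) := by
    rintro d - n (⟨hd, hn⟩ | ⟨-, rfl | rfl⟩)
    · exact exists_coeff_decimation hI hs h0 hn (Or.inr hd)
    · exact exists_coeff_decimation hI hs h0 (Or.inr rfl) (Or.inl rfl)
    · exact exists_coeff_decimation_sixteen hI hs h0 d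
  have single : ∀ d : ℕ, 0 < d → ∀ n ∈ associatedOrders d, ∀ r : ℤ,
      IsNonstrictSomos n (decimationIndex d r I) (decimation d r s) := fun d hd n hn r => by
    obtain ⟨a, ha, h⟩ := common d hd n hn
    exact ⟨a, ha, h r⟩
  exact ⟨fun d hd he r => ⟨single d hd 8 (Or.inl ⟨he, Or.inl rfl⟩) r,
      single d hd 9 (Or.inl ⟨he, Or.inr rfl⟩) r⟩,
    fun d hd ho r => ⟨single d hd 9 (Or.inr ⟨ho, Or.inl rfl⟩) r,
      single d hd 16 (Or.inr ⟨ho, Or.inr rfl⟩) r⟩, common⟩
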